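/- For an odd integer $v\ge 3$ and a block $C\subseteq\mathbf Z_v$, whose elements are represented by integers $0\le c_1<c_2<\dots<c_k\le v-1$, let $\Delta C$ be the multiset of the differences $c_i-c_j$ with $1\le j<i\le k$. A $(v,\{3,4\},1)$ perfect difference family is a set $\mathcal B$ of subsets (blocks) of $\mathbf Z_v$, each of size $3$ or $4$, such that the multiset union $\bigcup_{C\in\mathcal B}\Delta C$ consists of the elements $1,2,\dots,\frac{v-1}{2}$, each exactly once. If $\mathcal B$ has $s$ blocks of size $3$ and $t$ blocks of size $4$, its ratio of $4$-blocks is $\theta=\frac{t}{s+t}$. Theorem. For every integer $h\ge 2$ there is a $(6h+1,\{3,4\},1)$ perfect difference family whose ratio of $4$-blocks satisfies $\theta\ge\frac1{14}$ (families consisting of $4$-blocks only are allowed). Equivalently, for every integer $g\ge 13$ with $g\equiv 1\pmod 6$ there is a $(g,\{3,4\},1)$ perfect difference family with $\theta\ge\frac1{14}$. -/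

import Mathlib

/-- The directed list of differences of a block `C ⊆ ℤ/v`: list the elements of `C` in increasing
order of their representatives in `{0, …, v - 1}`, as `c₁ < c₂ < ⋯ < c_t`; the list is the multiset
of all `c_i - c_j` with `j < i`. -/
def directedDifferences {v : ℕ} (C : Finset (ZMod v)) : Multiset (ZMod v) :=
  ((C ×ˢ C).filter fun p => p.2.val < p.1.val).val.map fun p => p.1 - p.2

/-- The directed list of differences of a set of blocks: the multiset union (with multiplicities)
of the directed lists of differences of its blocks. -/
def familyDifferences {v : ℕ} (B : Finset (Finset (ZMod v))) : Multiset (ZMod v) :=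
  ∑ C ∈ B, directedDifferences C

/-- `B` is a `(v, K, 1)` perfect difference family: `v` is odd, every block has size in `K`, and
the directed list of differences of `B` consists of the residues `1, 2, …, (v - 1) / 2`,
each exactly once. -/
structure IsPerfectDifferenceFamily (v : ℕ) (K : Set ℕ) (B : Finset (Finset (ZMod v))) : Prop where
  odd : Odd v
  card_mem : ∀ C ∈ B, C.card ∈ K
  differences : familyDifferences B =
    (Finset.Icc 1 ((v - 1) / 2)).val.map fun d : ℕ => (d : ZMod v)

/-- The ratio of blocks of size `k` among all the blocks of `B`
(equal to `0` if `B` has no blocks). -/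
def blockRatio {v : ℕ} (k : ℕ) (B : Finset (Finset (ZMod v))) : ℚ :=
  ((B.filter fun C => C.card = k).card : ℚ) / (B.card : ℚ)

/-! Translating a block so that its least element is 0 leaves its differences unchanged, so a block
is given by its consecutive gaps. The theorem thus asks for a partition of the interval `{1, …, 3h}`
into triples `a, b, a + b` and sextuples of differences of 4-blocks. The condition `θ ≥ 1/14` says
that there are at most 13 triples per sextuple; this is preserved when two tilings are added and
when both counts are multiplied by the same factor.

The engine is a recursion of factor 5 (`HasTiling.inflate_Ioc`). Perturbing the gaps of each block
by five fixed offset vectors replaces every difference `d` by `5d - 2, …, 5d + 2`, so a tiling of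
`(a, b]` becomes a tiling of `(5a + 2, 5b + 2]`. Then `HasTiling.extend` adds the missing small
numbers together with `t` new numbers at the top. A block with exactly one gap at the top behaves
the same way wherever the top is, so one finite table over `ℕ × ℕ`, with `(i, x)` standing for `i *
m + x`, serves every right end `m`.

The recursion runs on the intervals `(6, 3h + 6]`. Inflation leaves `7, …, 32` uncovered at the
bottom, which is room enough for the five values of `t` needed to reach every residue of `h` modulo
5. Explicit tilings for `14 ≤ h < 92` start it (`hasTiling_Ioc_six`). One further extension, by `1,
…, 6` below and 12 numbers above, gives `{1, …, 3h}` for `h ≥ 20`; the cases `2 ≤ h < 20` are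
explicit (`hasTiling_Ioc_zero`). Finally `exists_isPerfectDifferenceFamily` turns a tiling into
blocks of residues.

`HasTiling` is stated over any additive commutative monoid because three are used: `ℕ` for checking
tables, `ℤ` for inflation with its negative offsets, and `ℕ × ℕ` for the tables with a symbolic top.
-/

/-- `S` is the multiset union of the differences `a`, `b`, `a + b` of some blocks of size 3 with
consecutive gaps `(a, b)`, and of the differences of some blocks of size 4 with consecutive gaps
`(a, b, c)`, there being at most 13 times as many blocks of size 3 as of size 4. -/
def HasTiling {G : Type*} [AddCommMonoid G] (S : Multiset G) : Prop :=
  ∃ (T : Multiset (G × G)) (Q : Multiset (G × G × G)),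
    (T.bind fun p => {p.1, p.2, p.1 + p.2}) +
      (Q.bind fun p => {p.1, p.2.1, p.2.2, p.1 + p.2.1, p.2.1 + p.2.2, p.1 + p.2.1 + p.2.2}) = S ∧
    T.card ≤ 13 * Q.card

/-! ### Tilings under sums, homomorphisms and inflation by 5. -/

namespace HasTiling

variable {G H : Type*} [AddCommMonoid G] [AddCommMonoid H]

theorem add {S S' : Multiset G} (h : HasTiling S) (h' : HasTiling S') : HasTiling (S + S') := by
  obtain ⟨T, Q, rfl, hc⟩ := h
  obtain ⟨T', Q', rfl, hc'⟩ := h'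
  refine ⟨T + T', Q + Q', ?_, ?_⟩
  · simp only [Multiset.add_bind]
    abel
  · simp only [Multiset.card_add]
    omega

/-- All differences are sums of gaps, so an additive map may be applied to the gaps alone. It serves
for the cast from `ℕ` to `ℤ` and for substituting an actual value of `m` into a table over `ℕ × ℕ`.
-/
theorem map {S : Multiset G} (h : HasTiling S) (f : G →+ H) : HasTiling (S.map f) := by
  obtain ⟨T, Q, rfl, hc⟩ := h
  refine ⟨T.map (Prod.map f f), Q.map (Prod.map f (Prod.map f f)), ?_, by simpa using hc⟩
  simp

/-- Multiplication by `5`: every difference `d` is replaced by the five differences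
`5 * d + e`, `-2 ≤ e ≤ 2`. -/
theorem inflate {S : Multiset ℤ} (h : HasTiling S) :
    HasTiling (S.bind fun d => (Multiset.map (fun e => 5 * d + e) {-2, -1, 0, 1, 2})) := by
  obtain ⟨T, Q, rfl, hc⟩ := h
  -- The offsets are chosen so that each coordinate, each sum of two adjacent coordinates, and the
  -- total of all three runs through `-2, …, 2` exactly once over the five vectors. Triples use only
  -- the first two coordinates.
  let P : Multiset (ℤ × ℤ × ℤ) :=
    {(0, -2, 0), (1, -1, 2), (2, 0, -1), (-2, 1, 1), (-1, 2, -2)}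
  refine ⟨T.bind fun p => P.map fun c => (5 * p.1 + c.1, 5 * p.2 + c.2.1),
    Q.bind fun p => P.map fun c => (5 * p.1 + c.1, 5 * p.2.1 + c.2.1, 5 * p.2.2 + c.2.2), ?_, ?_⟩
  -- Here `f` is the offset of one difference of the block and `g` the perturbed difference; the
  -- claim reduces to a finite check of `f` on `P`.
  · have key : ∀ (f g : ℤ × ℤ × ℤ → ℤ) (d : ℤ), P.map f = {-2, -1, 0, 1, 2} →
        (∀ c, g c = 5 * d + f c) →
        Multiset.map (fun e => 5 * d + e) {-2, -1, 0, 1, 2} = P.map g := by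
      intro f g d hf hg
      rw [← hf, Multiset.map_map]
      exact Multiset.map_congr rfl fun c _ => (hg c).symm
    rw [Multiset.add_bind, Multiset.bind_assoc, Multiset.bind_assoc, Multiset.bind_assoc,
      Multiset.bind_assoc]
    congr 1
    · refine Multiset.bind_congr fun p _ => ?_
      simp only [Multiset.insert_eq_cons, Multiset.cons_bind, Multiset.singleton_bind,
        Multiset.map_map, Function.comp_def, Multiset.bind_cons, Multiset.bind_singleton]
      simp only [← Multiset.insert_eq_cons]
      rw [key (fun c => c.1) _ p.1 (by decide) (fun c => rfl),
        key (fun c => c.2.1) _ p.2 (by decide) (fun c => rfl),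
        key (fun c => c.1 + c.2.1) (fun c => 5 * p.1 + c.1 + (5 * p.2 + c.2.1)) _
          (by decide) (fun c => by ring)]
    · refine Multiset.bind_congr fun p _ => ?_
      simp only [Multiset.insert_eq_cons, Multiset.cons_bind, Multiset.singleton_bind,
        Multiset.map_map, Function.comp_def, Multiset.bind_cons, Multiset.bind_singleton]
      simp only [← Multiset.insert_eq_cons]
      rw [key (fun c => c.1) _ p.1 (by decide) (fun c => rfl),
        key (fun c => c.2.1) _ p.2.1 (by decide) (fun c => rfl),
        key (fun c => c.2.2) _ p.2.2 (by decide) (fun c => rfl),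
        key (fun c => c.1 + c.2.1) (fun c => 5 * p.1 + c.1 + (5 * p.2.1 + c.2.1)) _
          (by decide) (fun c => by ring),
        key (fun c => c.2.1 + c.2.2) (fun c => 5 * p.2.1 + c.2.1 + (5 * p.2.2 + c.2.2)) _
          (by decide) (fun c => by ring),
        key (fun c => c.1 + c.2.1 + c.2.2)
          (fun c => 5 * p.1 + c.1 + (5 * p.2.1 + c.2.1) + (5 * p.2.2 + c.2.2)) _
          (by decide) (fun c => by ring)]
  · simp only [Multiset.card_bind, Function.comp_def, Multiset.card_map, Multiset.map_const',
      Multiset.sum_replicate, smul_eq_mul]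
    nlinarith [hc]

end HasTiling

/-- Inflating an integer interval gives an interval. -/
theorem HasTiling.inflate_Ioc {a b : ℤ} (h : HasTiling (Finset.Ioc a b).val) :
    HasTiling (Finset.Ioc (5 * a + 2) (5 * b + 2)).val := by
  convert h.inflate
  -- An integer is `5 * d + e` with `|e| ≤ 2` in exactly one way, so neither side has repetitions
  -- and comparing members suffices.
  refine Multiset.Nodup.ext (Finset.nodup _) ?_ |>.2 ?_
  · refine Multiset.nodup_bind.2 ⟨fun d _ => ?_, ?_⟩
    · exact Multiset.Nodup.map (fun x y hxy => by simpa using hxy) (by decide)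
    · refine (Finset.nodup _).pairwise fun x _ y _ hxy => ?_
      simp only [Function.onFun, Multiset.disjoint_left, Multiset.mem_map, Multiset.insert_eq_cons,
        Multiset.mem_cons, Multiset.mem_singleton]
      rintro z ⟨e, he, rfl⟩ ⟨e', he', h'⟩
      omega
  · intro x
    simp only [Finset.mem_val, Finset.mem_Ioc, Multiset.mem_bind, Multiset.mem_map,
      Multiset.insert_eq_cons, Multiset.mem_cons, Multiset.mem_singleton]
    constructor
    · intro hx
      -- Floor division after the shift by 2 gives the integer nearest to `x / 5`.
      exact ⟨(x + 2) / 5, by omega, x - 5 * ((x + 2) / 5), by omega, by omega⟩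
    · rintro ⟨d, hd, e, he, rfl⟩
      omega

/-! ### Verification of explicit tilings. -/

/-- Whether the bits of the accumulator `n` and the entries of the list are all distinct. -/
def distinctBits : ℕ → List ℕ → Bool
  | _, [] => true
  | n, d :: l => !n.testBit d && distinctBits (n ||| 2 ^ d) l

theorem nodup_of_distinctBits : ∀ (n : ℕ) (l : List ℕ), distinctBits n l = true →
    l.Nodup ∧ ∀ d ∈ l, n.testBit d = false
  | _, [], _ => by simp
  | n, d :: l, h => by
    simp only [distinctBits, Bool.and_eq_true, Bool.not_eq_true'] at h
    obtain ⟨ih, ih'⟩ := nodup_of_distinctBits _ l h.2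
    simp only [Nat.testBit_or, Nat.testBit_two_pow, Bool.or_eq_false_iff] at ih'
    refine ⟨List.nodup_cons.2 ⟨fun hd => ?_, ih⟩, ?_⟩
    · simpa using (ih' d hd).2
    · rintro e he
      rcases List.mem_cons.1 he with rfl | he
      · exact h.1
      · exact (ih' e he).1

/-- The list of differences of blocks given by their lists of gaps, of length 2 or 3. -/
def gapDifferences (T : List (ℕ × ℕ)) (Q : List (ℕ × ℕ × ℕ)) : List ℕ :=
  (T.flatMap fun p => [p.1, p.2, p.1 + p.2]) ++
    Q.flatMap fun p => [p.1, p.2.1, p.2.2, p.1 + p.2.1, p.2.1 + p.2.2, p.1 + p.2.1 + p.2.2]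

/-- A linear time test that the given gaps tile the interval `{a + 1, …, b}`. -/
def tilesIoc (a b : ℕ) (T : List (ℕ × ℕ)) (Q : List (ℕ × ℕ × ℕ)) : Bool :=
  distinctBits 0 (gapDifferences T Q) &&
    ((gapDifferences T Q).all fun d => Nat.blt a d && Nat.ble d b) &&
    Nat.beq (3 * T.length + 6 * Q.length) (b - a) && Nat.ble T.length (13 * Q.length)

theorem hasTiling_of_tilesIoc {a b : ℕ} {T : List (ℕ × ℕ)} {Q : List (ℕ × ℕ × ℕ)}
    (h : tilesIoc a b T Q = true) : HasTiling (Finset.Ioc (a : ℤ) b).val := by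
  simp only [tilesIoc, Bool.and_eq_true, List.all_eq_true, Nat.blt_eq, Nat.ble_eq,
    Nat.beq_eq] at h
  obtain ⟨⟨⟨h1, h2⟩, h3⟩, h4⟩ := h
  -- Distinct numbers in `(a, b]`, as many as the interval has elements, exhaust it; no search for
  -- each element is needed.
  have key : ((gapDifferences T Q : List ℕ) : Multiset ℕ) = (Finset.Ioc a b).val := by
    have hn := (nodup_of_distinctBits _ _ h1).1
    have : (⟨gapDifferences T Q, hn⟩ : Finset ℕ) = Finset.Ioc a b := by
      refine Finset.eq_of_subset_of_card_le (fun d hd => Finset.mem_Ioc.2 (h2 d hd)) ?_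
      rw [Nat.card_Ioc, ← h3]
      simp [gapDifferences, List.length_flatMap]
      omega
    rw [← this]
  have hN : HasTiling (Finset.Ioc a b).val := by
    refine ⟨T, Q, ?_, by simpa using h4⟩
    rw [← key, gapDifferences, ← Multiset.coe_add, ← Multiset.coe_bind, ← Multiset.coe_bind]
    rfl
  convert hN.map (Nat.castAddMonoidHom ℤ)
  refine Multiset.Nodup.ext (Finset.nodup _) ?_ |>.2 ?_
  · exact Multiset.Nodup.map (fun x y hxy => by simpa using hxy) (Finset.nodup _)
  · intro x
    simp only [Finset.mem_val, Finset.mem_Ioc, Multiset.mem_map, Nat.coe_castAddMonoidHom]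
    constructor
    · intro hx
      exact ⟨x.toNat, by omega, by omega⟩
    · rintro ⟨d, hd, rfl⟩
      omega

/-! ### Extension of a tiled interval at both ends. -/

/-- The elements `(0, c + 1), …, (0, k)` and `(1, 1), …, (1, t)` of `ℕ × ℕ`. -/
def lowAndTop (c k t : ℕ) : Multiset (ℕ × ℕ) :=
  (((List.range' (c + 1) (k - c)).map fun x => (0, x)) ++
    ((List.range' 1 t).map fun x => (1, x)) : List (ℕ × ℕ))

/-- A tiling of the interval `(k, m]` can be extended at both ends to the interval `(c, m + t]`. -/
theorem HasTiling.extend {c k t : ℕ} {m : ℤ} (hck : c ≤ k) (hkm : k ≤ m)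
    (h : HasTiling (Finset.Ioc (k : ℤ) m).val) (hg : HasTiling (lowAndTop c k t)) :
    HasTiling (Finset.Ioc (c : ℤ) (m + t)).val := by
  -- The substitution `(i, x) ↦ i * m + x` is additive, so it carries the table to a tiling of `(c,
  -- k]` together with `(m, m + t]`. The hypothesis `k ≤ m` keeps these two parts apart.
  let f : ℕ × ℕ →+ ℤ :=
    ((AddMonoidHom.mulRight m).comp ((Nat.castAddMonoidHom ℤ).comp (AddMonoidHom.fst ℕ ℕ))) +
      (Nat.castAddMonoidHom ℤ).comp (AddMonoidHom.snd ℕ ℕ)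
  have hf : ∀ p : ℕ × ℕ, f p = p.1 * m + p.2 := fun p => rfl
  convert h.add (hg.map f)
  rw [lowAndTop, ← Multiset.coe_add, Multiset.map_add, Multiset.map_coe, Multiset.map_coe,
    List.map_map, List.map_map, Function.comp_def, Function.comp_def]
  simp only [hf, Nat.cast_zero, zero_mul, zero_add, Nat.cast_one, one_mul]
  refine Multiset.Nodup.ext (Finset.nodup _) ?_ |>.2 ?_
  · rw [Multiset.nodup_add, Multiset.nodup_add]
    refine ⟨Finset.nodup _, ⟨?_, ?_, ?_⟩, ?_⟩
    · exact List.Nodup.map (fun x y hxy => by simpa using hxy) List.nodup_range'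
    · exact List.Nodup.map (fun x y hxy => by simpa using hxy) List.nodup_range'
    · rw [Multiset.disjoint_left]
      simp only [Multiset.mem_coe, List.mem_map, List.mem_range'_1]
      rintro _ ⟨x, hx, rfl⟩ ⟨y, hy, hxy⟩
      omega
    · rw [Multiset.disjoint_left]
      simp only [Multiset.mem_add, Multiset.mem_coe, List.mem_map, List.mem_range'_1,
        Finset.mem_val, Finset.mem_Ioc]
      rintro _ h0 (⟨x, hx, rfl⟩ | ⟨y, hy, rfl⟩) <;> omega
  · intro x
    simp only [Multiset.mem_add, Multiset.mem_coe, List.mem_map, List.mem_range'_1,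
      Finset.mem_val, Finset.mem_Ioc]
    constructor
    · intro hx
      by_cases h1 : x ≤ k
      · exact Or.inr (Or.inl ⟨x.toNat, by omega, by omega⟩)
      · by_cases h2 : x ≤ m
        · exact Or.inl ⟨by omega, h2⟩
        · exact Or.inr (Or.inr ⟨(x - m).toNat, by omega, by omega⟩)
    · rintro (hx | ⟨y, hy, rfl⟩ | ⟨y, hy, rfl⟩) <;> omega

/-! ### From gaps to blocks of residues. -/

/-- As the gaps are positive and their sum is below `v`, nothing wraps around: the representatives
are `0 < a < a + b`. The differences may coincide (`a = b` is allowed), but the pairs producing them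
are distinct, so the multiset is computed from an explicit set of pairs. -/
theorem directedDifferences_triple {v : ℕ} {a b : ℕ} (ha : 0 < a) (hb : 0 < b) (h : a + b < v) :
    directedDifferences ({0, (a : ZMod v), (a : ZMod v) + b} : Finset (ZMod v)) =
      {(a : ZMod v), (b : ZMod v), (a : ZMod v) + b} := by
  have : NeZero v := ⟨by omega⟩
  have v1 : (a : ZMod v).val = a := ZMod.val_cast_of_lt (by omega)
  have v2 : ((a : ZMod v) + b).val = a + b := by
    rw [← Nat.cast_add]; exact ZMod.val_cast_of_lt (by omega)
  have v0 : (0 : ZMod v).val = 0 := ZMod.val_zero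
  have hf : ((({0, (a : ZMod v), (a : ZMod v) + b} : Finset (ZMod v)) ×ˢ
      ({0, (a : ZMod v), (a : ZMod v) + b} : Finset (ZMod v))).filter
        fun p => p.2.val < p.1.val) =
      {((a : ZMod v), 0), ((a : ZMod v) + b, (a : ZMod v)), ((a : ZMod v) + b, 0)} := by
    ext ⟨x, y⟩
    simp only [Finset.mem_filter, Finset.mem_product, Finset.mem_insert, Finset.mem_singleton,
      Prod.mk.injEq]
    constructor
    · rintro ⟨⟨rfl | rfl | rfl, rfl | rfl | rfl⟩, h⟩ <;> simp only [v0, v1, v2] at h <;>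
        first | omega | simp
    · rintro (⟨rfl, rfl⟩ | ⟨rfl, rfl⟩ | ⟨rfl, rfl⟩) <;> simp [v1, v2] <;> omega
  have n1 : (a : ZMod v) ≠ (a : ZMod v) + b := fun e => by
    have := congrArg ZMod.val e; omega
  have n2 : (a : ZMod v) ≠ 0 := fun e => by
    have := congrArg ZMod.val e; omega
  rw [directedDifferences, hf, Finset.insert_val_of_notMem (by simp [n1]),
    Finset.insert_val_of_notMem (by simp [n2])]
  simp

theorem directedDifferences_quadruple {v : ℕ} {a b c : ℕ} (ha : 0 < a) (hb : 0 < b) (hc : 0 < c)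
    (h : a + b + c < v) :
    directedDifferences
        ({0, (a : ZMod v), (a : ZMod v) + b, (a : ZMod v) + b + c} : Finset (ZMod v)) =
      {(a : ZMod v), (b : ZMod v), (c : ZMod v), (a : ZMod v) + b, (b : ZMod v) + c,
        (a : ZMod v) + b + c} := by
  have : NeZero v := ⟨by omega⟩
  have v1 : (a : ZMod v).val = a := ZMod.val_cast_of_lt (by omega)
  have v2 : ((a : ZMod v) + b).val = a + b := by
    rw [← Nat.cast_add]; exact ZMod.val_cast_of_lt (by omega)
  have v3 : ((a : ZMod v) + b + c).val = a + b + c := by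
    rw [← Nat.cast_add, ← Nat.cast_add]; exact ZMod.val_cast_of_lt (by omega)
  have v0 : (0 : ZMod v).val = 0 := ZMod.val_zero
  have hf : ((({0, (a : ZMod v), (a : ZMod v) + b, (a : ZMod v) + b + c} : Finset (ZMod v)) ×ˢ
      ({0, (a : ZMod v), (a : ZMod v) + b, (a : ZMod v) + b + c} : Finset (ZMod v))).filter
        fun p => p.2.val < p.1.val) =
      {((a : ZMod v), 0), ((a : ZMod v) + b, (a : ZMod v)),
        ((a : ZMod v) + b + c, (a : ZMod v) + b), ((a : ZMod v) + b, 0),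
        ((a : ZMod v) + b + c, (a : ZMod v)), ((a : ZMod v) + b + c, 0)} := by
    ext ⟨x, y⟩
    simp only [Finset.mem_filter, Finset.mem_product, Finset.mem_insert, Finset.mem_singleton,
      Prod.mk.injEq]
    constructor
    · rintro ⟨⟨rfl | rfl | rfl | rfl, rfl | rfl | rfl | rfl⟩, h⟩ <;>
        simp only [v0, v1, v2, v3] at h <;> first | omega | simp
    · rintro (⟨rfl, rfl⟩ | ⟨rfl, rfl⟩ | ⟨rfl, rfl⟩ | ⟨rfl, rfl⟩ | ⟨rfl, rfl⟩ | ⟨rfl, rfl⟩) <;>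
        simp [v1, v2, v3] <;> omega
  have n01 : (a : ZMod v) ≠ 0 := fun e => by
    have := congrArg ZMod.val e; omega
  have n02 : (a : ZMod v) + b ≠ 0 := fun e => by
    have := congrArg ZMod.val e; omega
  have n12 : (a : ZMod v) ≠ (a : ZMod v) + b := fun e => by
    have := congrArg ZMod.val e; omega
  have n13 : (a : ZMod v) ≠ (a : ZMod v) + b + c := fun e => by
    have := congrArg ZMod.val e; omega
  have n23 : (a : ZMod v) + b ≠ (a : ZMod v) + b + c := fun e => by
    have := congrArg ZMod.val e; omega
  rw [directedDifferences, hf,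
    Finset.insert_val_of_notMem (by
      simp only [Finset.mem_insert, Finset.mem_singleton, Prod.mk.injEq]; tauto),
    Finset.insert_val_of_notMem (by
      simp only [Finset.mem_insert, Finset.mem_singleton, Prod.mk.injEq]; tauto),
    Finset.insert_val_of_notMem (by
      simp only [Finset.mem_insert, Finset.mem_singleton, Prod.mk.injEq]; tauto),
    Finset.insert_val_of_notMem (by
      simp only [Finset.mem_insert, Finset.mem_singleton, Prod.mk.injEq]; tauto),
    Finset.insert_val_of_notMem (by
      simp only [Finset.mem_singleton, Prod.mk.injEq]; tauto)]
  simp only [Finset.singleton_val, Multiset.map_cons, Multiset.map_singleton,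
    Multiset.insert_eq_cons]
  congr 1
  · ring
  congr 1
  · ring
  congr 1
  · ring
  congr 1
  · ring
  congr 1
  · ring
  · ring_nf

theorem card_triple {v : ℕ} {a b : ℕ} (ha : 0 < a) (hb : 0 < b) (h : a + b < v) :
    ({0, (a : ZMod v), (a : ZMod v) + b} : Finset (ZMod v)).card = 3 := by
  have : NeZero v := ⟨by omega⟩
  have v1 : (a : ZMod v).val = a := ZMod.val_cast_of_lt (by omega)
  have v2 : ((a : ZMod v) + b).val = a + b := by
    rw [← Nat.cast_add]; exact ZMod.val_cast_of_lt (by omega)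
  have v0 : (0 : ZMod v).val = 0 := ZMod.val_zero
  refine Finset.card_eq_three.2 ⟨_, _, _, ?_, ?_, ?_, rfl⟩ <;> intro e <;>
    have := congrArg ZMod.val e <;> omega

theorem card_quadruple {v : ℕ} {a b c : ℕ} (ha : 0 < a) (hb : 0 < b) (hc : 0 < c)
    (h : a + b + c < v) :
    ({0, (a : ZMod v), (a : ZMod v) + b, (a : ZMod v) + b + c} : Finset (ZMod v)).card = 4 := by
  have : NeZero v := ⟨by omega⟩
  have v3 : ((a : ZMod v) + b + c).val = a + b + c := by
    rw [← Nat.cast_add, ← Nat.cast_add]; exact ZMod.val_cast_of_lt (by omega)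
  have v1 : (a : ZMod v).val = a := ZMod.val_cast_of_lt (by omega)
  have v2 : ((a : ZMod v) + b).val = a + b := by
    rw [← Nat.cast_add]; exact ZMod.val_cast_of_lt (by omega)
  have v0 : (0 : ZMod v).val = 0 := ZMod.val_zero
  have hs : ({0, (a : ZMod v), (a : ZMod v) + b, (a : ZMod v) + b + c} : Finset (ZMod v)) =
      {(a : ZMod v) + b + c, 0, (a : ZMod v), (a : ZMod v) + b} := by
    ext; simp only [Finset.mem_insert, Finset.mem_singleton]; tauto
  rw [hs, Finset.card_insert_of_notMem, card_triple ha hb (by omega)]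
  simp only [Finset.mem_insert, Finset.mem_singleton]
  rintro (e | e | e) <;> have := congrArg ZMod.val e <;> omega

/-- A multiset of nonempty blocks whose differences have no repetition has no repetition. -/
theorem nodup_of_nodup_sum_map {α β : Type*} {M : Multiset α} {f : α → Multiset β}
    (h : (M.map f).sum.Nodup) (h0 : ∀ x ∈ M, f x ≠ 0) : M.Nodup := by
  classical
  rw [Multiset.nodup_iff_le]
  intro x hx
  -- If `x` occurred twice, any `d` in `f x` would be counted at least twice in the sum.
  obtain ⟨N, rfl⟩ := Multiset.le_iff_exists_add.1 hx
  obtain ⟨d, hd⟩ := Multiset.exists_mem_of_ne_zero (h0 x (by simp))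
  have h' := Multiset.nodup_iff_count_le_one.1 h d
  have := Multiset.count_pos.2 hd
  simp only [Multiset.map_add, Multiset.map_cons, Multiset.sum_add, Multiset.sum_cons,
    Multiset.count_add] at h'
  omega

/-- A tiling of `{1, …, 3 * h}` yields a perfect difference family over `ZMod (6 * h + 1)`. -/
theorem exists_isPerfectDifferenceFamily {h : ℕ} (hh : 0 < h)
    (ht : HasTiling (Finset.Ioc (0 : ℤ) (3 * h)).val) :
    ∃ B : Finset (Finset (ZMod (6 * h + 1))),
      IsPerfectDifferenceFamily (6 * h + 1) {3, 4} B ∧ 1 / 14 ≤ blockRatio 4 B := by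
  obtain ⟨T, Q, hTQ, hcard⟩ := ht
  -- Positivity of the gaps and the bound `3 * h < 6 * h + 1` on the span of each block come for
  -- free, since all of these are themselves differences in the tiled interval.
  have hmem : ∀ x : ℤ, (x ∈ (T.bind fun p => {p.1, p.2, p.1 + p.2}) +
      (Q.bind fun p => {p.1, p.2.1, p.2.2, p.1 + p.2.1, p.2.1 + p.2.2,
        p.1 + p.2.1 + p.2.2})) → 0 < x ∧ x ≤ 3 * h := by
    intro x hx
    rw [hTQ] at hx
    exact Finset.mem_Ioc.1 hx
  have hT : ∀ p ∈ T, 0 < p.1 ∧ 0 < p.2 ∧ p.1 + p.2 ≤ 3 * h := by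
    intro p hp
    refine ⟨(hmem _ ?_).1, (hmem _ ?_).1, (hmem _ ?_).2⟩ <;>
      exact Multiset.mem_add.2 (Or.inl (Multiset.mem_bind.2 ⟨p, hp, by simp⟩))
  have hQ : ∀ p ∈ Q, 0 < p.1 ∧ 0 < p.2.1 ∧ 0 < p.2.2 ∧ p.1 + p.2.1 + p.2.2 ≤ 3 * h := by
    intro p hp
    refine ⟨(hmem _ ?_).1, (hmem _ ?_).1, (hmem _ ?_).1, (hmem _ ?_).2⟩ <;>
      exact Multiset.mem_add.2 (Or.inr (Multiset.mem_bind.2 ⟨p, hp, by simp⟩))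
  let R := ZMod (6 * h + 1)
  let F : ℤ × ℤ → Finset R := fun p => {0, (p.1 : R), (p.1 : R) + (p.2 : R)}
  let G : ℤ × ℤ × ℤ → Finset R := fun p =>
    {0, (p.1 : R), (p.1 : R) + (p.2.1 : R), (p.1 : R) + (p.2.1 : R) + (p.2.2 : R)}
  have hF : ∀ p ∈ T, (F p).card = 3 ∧ directedDifferences (F p) =
      ({p.1, p.2, p.1 + p.2} : Multiset ℤ).map ((↑) : ℤ → R) := by
    rintro ⟨a, b⟩ hp
    obtain ⟨h1, h2, h3⟩ := hT _ hp
    lift a to ℕ using h1.le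
    lift b to ℕ using h2.le
    have := card_triple (v := 6 * h + 1) (a := a) (b := b) (by simpa using h1) (by simpa using h2)
      (by simp only at h3; omega)
    have := directedDifferences_triple (v := 6 * h + 1) (a := a) (b := b) (by simpa using h1)
      (by simpa using h2) (by simp only at h3; omega)
    simp only [F, R]
    push_cast
    simp_all
  have hG : ∀ p ∈ Q, (G p).card = 4 ∧ directedDifferences (G p) =
      ({p.1, p.2.1, p.2.2, p.1 + p.2.1, p.2.1 + p.2.2, p.1 + p.2.1 + p.2.2} : Multiset ℤ).map
        ((↑) : ℤ → R) := by
    rintro ⟨a, b, c⟩ hp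
    obtain ⟨h1, h2, h3, h4⟩ := hQ _ hp
    lift a to ℕ using h1.le
    lift b to ℕ using h2.le
    lift c to ℕ using h3.le
    have := card_quadruple (v := 6 * h + 1) (a := a) (b := b) (c := c) (by simpa using h1)
      (by simpa using h2) (by simpa using h3) (by simp only at h4; omega)
    have := directedDifferences_quadruple (v := 6 * h + 1) (a := a) (b := b) (c := c)
      (by simpa using h1) (by simpa using h2) (by simpa using h3) (by simp only at h4; omega)
    simp only [G, R]
    push_cast
    simp_all
  let M : Multiset (Finset R) := T.map F + Q.map G
  have hsum : (M.map directedDifferences).sum =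
      (Finset.Icc 1 ((6 * h + 1 - 1) / 2)).val.map fun d : ℕ => (d : R) := by
    have e1 : (M.map directedDifferences).sum =
        (Finset.Ioc (0 : ℤ) (3 * h)).val.map ((↑) : ℤ → R) := by
      rw [← hTQ, Multiset.map_add, Multiset.map_add, Multiset.map_bind, Multiset.map_bind,
        Multiset.sum_add, Multiset.map_map, Multiset.map_map]
      exact congrArg₂ (· + ·)
        (congrArg Multiset.sum (Multiset.map_congr rfl fun p hp => (hF p hp).2))
        (congrArg Multiset.sum (Multiset.map_congr rfl fun p hp => (hG p hp).2))
    have e2 : (Finset.Ioc (0 : ℤ) (3 * h)) =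
        (Finset.Icc 1 ((6 * h + 1 - 1) / 2)).map Nat.castEmbedding := by
      ext x
      simp only [Finset.mem_Ioc, Finset.mem_map, Finset.mem_Icc, Nat.castEmbedding_apply]
      constructor
      · intro hx
        exact ⟨x.toNat, by omega, by omega⟩
      · rintro ⟨y, hy, rfl⟩
        omega
    rw [e1, e2, Finset.map_val, Multiset.map_map]
    refine Multiset.map_congr rfl fun d _ => by simp
  -- The family must be a set of blocks. The residues `1, …, 3 * h` are distinct modulo `6 * h + 1`
  -- and every block has a difference, so no block is repeated.
  have hM : M.Nodup := by
    refine nodup_of_nodup_sum_map (f := directedDifferences) ?_ ?_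
    · rw [hsum]
      refine Multiset.Nodup.map_on ?_ (Finset.nodup _)
      intro x hx y hy hxy
      simp only [Finset.mem_val, Finset.mem_Icc] at hx hy
      have := congrArg ZMod.val hxy
      rwa [ZMod.val_cast_of_lt (by omega), ZMod.val_cast_of_lt (by omega)] at this
    · intro C hC
      rcases Multiset.mem_add.1 hC with hC | hC
      · obtain ⟨p, hp, rfl⟩ := Multiset.mem_map.1 hC
        rw [(hF p hp).2]
        simp
      · obtain ⟨p, hp, rfl⟩ := Multiset.mem_map.1 hC
        rw [(hG p hp).2]
        simp
  -- With no 4-block the bound 13 would exclude triples as well, leaving the nonempty interval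
  -- uncovered. This makes the denominator of the ratio positive.
  have hpos : 0 < Q.card := by
    by_contra hq
    have hq0 : Q = 0 := Multiset.card_eq_zero.1 (by omega)
    have ht0 : T = 0 := Multiset.card_eq_zero.1 (by omega)
    have := congrArg Multiset.card hTQ
    simp [hq0, ht0] at this
    omega
  refine ⟨⟨M, hM⟩, ⟨⟨3 * h, by ring⟩, ?_, hsum⟩, ?_⟩
  · intro C hC
    rcases Multiset.mem_add.1 (Finset.mem_mk.1 hC) with hC | hC
    · obtain ⟨p, hp, rfl⟩ := Multiset.mem_map.1 hC
      exact Or.inl (hF p hp).1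
    · obtain ⟨p, hp, rfl⟩ := Multiset.mem_map.1 hC
      exact Or.inr (hG p hp).1
  · have c1 : (Finset.card (⟨M, hM⟩ : Finset (Finset R))) = T.card + Q.card := by
      simp [Finset.card, M]
    have c2 : ((⟨M, hM⟩ : Finset (Finset R)).filter fun C => C.card = 4).card = Q.card := by
      rw [Finset.card, Finset.filter_val]
      simp only [M, Multiset.filter_add, Multiset.card_add]
      rw [Multiset.filter_eq_nil.2, Multiset.filter_eq_self.2]
      · simp
      · intro C hC
        obtain ⟨p, hp, rfl⟩ := Multiset.mem_map.1 hC
        exact (hG p hp).1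
      · intro C hC
        obtain ⟨p, hp, rfl⟩ := Multiset.mem_map.1 hC
        rw [(hF p hp).1]
        decide
    rw [blockRatio, c1, c2, div_le_div_iff₀ (by norm_num) (by positivity)]
    have : T.card + Q.card ≤ 14 * Q.card := by omega
    exact_mod_cast (by omega : 1 * (T.card + Q.card) ≤ Q.card * 14)

/-! ### Explicit tilings for the base cases. -/

/-- The gaps of tilings of `{1, …, 3 * (i + 2)}` for `i < 18`. -/
def initialTilings : List (List (ℕ × ℕ) × List (ℕ × ℕ × ℕ)) :=
  [
   ([], [(1, 3, 2)]),
   ([(1, 7)], [(3, 2, 4)]),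
   ([(2, 8), (3, 9)], [(4, 1, 6)]),
   ([(1, 12), (4, 6), (7, 8)], [(3, 2, 9)]),
   ([(2, 14), (3, 12), (4, 9), (5, 6)], [(1, 7, 10)]),
   ([(1, 17), (2, 7), (3, 13), (5, 14), (8, 12)], [(6, 4, 11)]),
   ([(1, 22), (3, 18), (4, 15), (5, 12), (6, 7), (9, 11)], [(8, 2, 14)]),
   ([(2, 25), (3, 20), (4, 15), (5, 11), (6, 18), (9, 17), (10, 12)], [(7, 1, 13)]),
   ([(2, 28), (3, 26), (4, 17), (5, 18), (6, 16), (7, 20), (8, 11), (12, 13)], [(9, 1, 14)]),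
   ([(1, 31), (2, 28), (3, 26), (4, 14), (5, 16), (6, 13), (7, 20), (8, 17), (9, 15)], [(10, 12,
   11)]),
   ([(1, 35), (3, 31), (4, 29), (5, 23), (6, 15), (7, 17), (8, 19), (9, 13), (10, 16), (11, 14)],
   [(2, 18, 12)]),
   ([(1, 37), (2, 34), (3, 32), (4, 18), (6, 21), (7, 19), (8, 16), (10, 23), (11, 20), (12, 17),
   (13, 15)], [(9, 5, 25)]),
   ([(1, 41), (3, 37), (4, 35), (5, 26), (7, 15), (9, 25), (10, 23), (11, 17), (12, 24), (13, 19),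
   (14, 16), (18, 20)], [(2, 6, 21)]),
   ([(1, 44), (3, 40), (4, 38), (5, 31), (6, 20), (7, 25), (8, 21), (9, 24), (11, 23), (13, 15),
   (14, 16), (17, 18), (19, 22)], [(2, 10, 27)]),
   ([(1, 44), (2, 27), (3, 31), (5, 35), (7, 32), (9, 33), (13, 30), (15, 23), (16, 25), (17, 19),
   (20, 28), (22, 24)], [(10, 11, 26), (4, 8, 6)]),
   ([(1, 40), (2, 47), (4, 44), (6, 36), (7, 28), (8, 29), (10, 23), (11, 19), (14, 32), (15, 24),
   (16, 34), (18, 27), (20, 31)], [(3, 9, 13), (5, 21, 17)]),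
   ([(1, 53), (2, 50), (3, 48), (5, 41), (6, 31), (7, 36), (10, 23), (11, 21), (12, 27), (13, 22),
   (14, 26), (15, 19), (16, 28), (18, 24)], [(9, 8, 30), (4, 25, 20)]),
   ([(1, 29), (2, 55), (3, 49), (5, 27), (6, 45), (7, 43), (8, 40), (9, 35), (10, 31), (11, 15),
   (12, 21), (13, 34), (14, 23), (16, 38), (25, 28)], [(17, 19, 20), (4, 18, 24)])]

set_option maxRecDepth 20000 in
/-- The gaps of tilings of `{7, …, 3 * (i + 14) + 6}` for `i < 78`. -/
def shiftedTilings : List (List (ℕ × ℕ) × List (ℕ × ℕ × ℕ)) :=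
  [
   ([(7, 27), (8, 35), (9, 31), (11, 26), (12, 32), (13, 28), (14, 22), (16, 30), (17, 25), (18,
   29), (19, 20), (21, 24)], [(10, 23, 15)]),
   ([(7, 37), (8, 28), (9, 31), (10, 33), (11, 38), (12, 35), (14, 25), (15, 27), (17, 24), (18,
   30), (19, 32), (20, 26), (22, 23)], [(16, 13, 21)]),
   ([(7, 36), (9, 41), (12, 32), (13, 38), (15, 33), (16, 31), (17, 29), (18, 34), (19, 21), (20,
   22), (23, 26), (24, 30)], [(14, 11, 28), (8, 27, 10)]),
   ([(7, 40), (8, 38), (9, 42), (10, 35), (11, 37), (13, 39), (14, 29), (16, 41), (20, 34), (21,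
   23), (22, 27), (25, 28), (26, 30)], [(17, 15, 18), (19, 12, 24)]),
   ([(7, 35), (8, 37), (10, 44), (11, 41), (12, 46), (14, 29), (15, 40), (16, 34), (18, 33), (20,
   39), (21, 27), (22, 38), (25, 28), (26, 31)], [(9, 23, 24), (13, 17, 19)]),
   ([(9, 48), (10, 34), (11, 45), (12, 51), (13, 28), (14, 47), (15, 43), (16, 33), (18, 37), (20,
   32), (21, 29), (22, 40), (24, 30), (25, 35), (26, 27)], [(17, 19, 23), (7, 31, 8)]),
   ([(8, 56), (10, 39), (11, 50), (12, 40), (14, 37), (15, 43), (16, 38), (17, 45), (19, 44), (20,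
   28), (21, 32), (23, 36), (24, 41), (26, 34), (27, 30), (31, 35)], [(18, 7, 22), (9, 33, 13)]),
   ([(7, 59), (8, 47), (9, 45), (11, 42), (14, 43), (15, 35), (16, 48), (17, 32), (19, 46), (20,
   36), (21, 30), (22, 41), (23, 44), (24, 37), (26, 34), (29, 33), (31, 38)], [(13, 12, 27), (10,
   18, 40)]),
   ([(7, 45), (9, 44), (10, 49), (11, 61), (12, 55), (13, 51), (15, 50), (16, 46), (18, 42), (21,
   35), (22, 32), (23, 48), (24, 34), (25, 38), (27, 41), (29, 40), (30, 36), (33, 37)], [(14, 17,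
   26), (8, 20, 19)]),
   ([(8, 53), (10, 64), (11, 47), (12, 50), (13, 38), (14, 43), (15, 52), (17, 48), (18, 42), (19,
   54), (20, 35), (22, 46), (24, 45), (25, 34), (26, 40), (27, 36), (29, 41), (31, 44), (32, 39)],
   [(7, 21, 9), (16, 33, 23)]),
   ([(7, 48), (9, 65), (10, 67), (12, 47), (13, 58), (14, 46), (15, 51), (16, 38), (17, 44), (18,
   21), (19, 45), (20, 52), (22, 40), (23, 50), (24, 29), (25, 31), (26, 49), (28, 35), (32, 37),
   (33, 43)], [(11, 30, 27), (8, 34, 36)]),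
   ([(9, 61), (11, 60), (12, 45), (13, 63), (14, 48), (16, 51), (17, 39), (19, 36), (20, 49), (21,
   58), (23, 52), (24, 40), (25, 43), (26, 54), (27, 50), (28, 53), (30, 35), (31, 42), (32, 46),
   (33, 41), (34, 38)], [(10, 8, 29), (7, 15, 44)]),
   ([(7, 48), (8, 59), (9, 72), (10, 29), (12, 61), (13, 62), (14, 60), (15, 64), (16, 36), (17,
   46), (18, 58), (19, 37), (20, 49), (21, 50), (24, 54), (26, 57), (28, 40), (30, 35), (31, 51),
   (32, 34), (33, 44), (41, 43)], [(27, 11, 42), (23, 22, 25)]),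
   ([(7, 66), (8, 22), (11, 56), (12, 65), (14, 54), (15, 59), (16, 45), (17, 53), (18, 63), (19,
   60), (20, 49), (21, 36), (24, 47), (25, 39), (26, 52), (27, 31), (28, 55), (29, 51), (32, 50),
   (35, 37), (38, 48), (40, 44), (41, 46)], [(33, 9, 34), (10, 13, 62)]),
   ([(7, 83), (8, 79), (9, 52), (10, 58), (11, 44), (12, 73), (13, 71), (14, 53), (16, 56), (17,
   57), (21, 49), (23, 66), (24, 51), (25, 37), (26, 43), (27, 38), (28, 60), (29, 47), (30, 50),
   (31, 33), (32, 45), (34, 48), (36, 42), (40, 46)], [(18, 41, 22), (15, 20, 19)]),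
   ([(7, 75), (8, 49), (9, 77), (10, 61), (11, 65), (13, 80), (15, 55), (17, 66), (18, 67), (19,
   44), (20, 28), (21, 60), (22, 56), (23, 51), (24, 64), (25, 62), (26, 53), (27, 46), (31, 37),
   (32, 40), (33, 36), (34, 58), (38, 52), (39, 45), (41, 50)], [(16, 14, 29), (35, 12, 42)]),
   ([(7, 78), (8, 76), (9, 59), (10, 57), (11, 70), (13, 27), (14, 42), (15, 73), (16, 53), (17,
   48), (19, 75), (20, 63), (22, 74), (24, 55), (25, 62), (26, 46), (28, 49), (29, 66), (31, 58),
   (32, 39), (33, 60), (35, 45), (36, 50), (37, 54), (41, 51), (43, 47)], [(12, 18, 34), (21, 23,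
   38)]),
   ([(7, 92), (9, 68), (10, 88), (11, 86), (13, 52), (14, 79), (15, 54), (16, 46), (17, 63), (18,
   55), (19, 64), (20, 50), (21, 57), (22, 60), (23, 51), (24, 67), (25, 47), (27, 44), (29, 66),
   (33, 48), (34, 56), (36, 49), (37, 39), (41, 53), (42, 45)], [(12, 26, 58), (28, 31, 30), (32,
   8, 35)]),
   ([(7, 58), (8, 64), (9, 92), (10, 53), (12, 84), (13, 78), (14, 85), (15, 79), (17, 81), (18,
   37), (21, 62), (22, 68), (23, 66), (25, 51), (28, 52), (29, 48), (30, 44), (31, 57), (32, 54),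
   (33, 38), (34, 41), (35, 67), (36, 46), (39, 56), (40, 60), (47, 50)], [(20, 49, 24), (11, 16,
   43), (26, 19, 42)]),
   ([(7, 70), (10, 89), (11, 58), (12, 72), (13, 79), (15, 78), (16, 86), (17, 59), (18, 80), (19,
   82), (20, 47), (22, 65), (24, 64), (25, 56), (27, 44), (28, 62), (29, 74), (30, 45), (31, 66),
   (33, 63), (34, 39), (36, 68), (37, 54), (41, 53), (42, 43), (48, 52), (50, 55)], [(38, 8, 49),
   (21, 14, 26), (23, 9, 51)]),
   ([(7, 66), (8, 54), (9, 85), (10, 93), (11, 81), (12, 78), (13, 61), (15, 83), (16, 55), (17,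
   69), (18, 84), (20, 52), (21, 79), (22, 82), (25, 76), (26, 41), (27, 80), (29, 39), (30, 35),
   (31, 75), (34, 63), (38, 53), (40, 59), (42, 47), (43, 44), (46, 49), (48, 57), (50, 58)], [(24,
   36, 28), (19, 32, 45), (14, 23, 33)]),
   ([(8, 81), (9, 101), (10, 99), (12, 72), (14, 65), (15, 75), (16, 88), (17, 85), (19, 86), (20,
   53), (21, 74), (22, 47), (23, 43), (26, 57), (27, 76), (29, 51), (30, 67), (31, 61), (32, 50),
   (33, 58), (34, 77), (35, 63), (38, 56), (39, 54), (40, 68), (41, 46), (44, 52), (45, 55), (48,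
   59)], [(7, 11, 60), (36, 28, 42), (13, 24, 25)]),
   ([(7, 99), (8, 94), (10, 50), (11, 82), (12, 61), (13, 88), (14, 96), (15, 85), (16, 64), (17,
   86), (18, 77), (19, 49), (20, 67), (22, 70), (23, 84), (24, 52), (25, 65), (27, 81), (28, 29),
   (31, 58), (32, 37), (33, 45), (34, 40), (35, 62), (36, 39), (41, 71), (43, 48), (44, 54), (46,
   59), (55, 56)], [(42, 21, 51), (9, 38, 66), (26, 53, 30)]),
   ([(7, 9), (8, 88), (10, 97), (11, 102), (13, 77), (17, 63), (18, 81), (19, 91), (20, 78), (21,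
   68), (22, 94), (23, 83), (24, 61), (25, 45), (28, 73), (29, 75), (30, 57), (31, 64), (32, 39),
   (33, 49), (34, 50), (35, 37), (36, 69), (38, 79), (40, 52), (42, 51), (43, 65), (46, 66), (47,
   67), (53, 58), (54, 55)], [(12, 48, 26), (15, 44, 56), (27, 14, 62)]),
   ([(7, 80), (8, 76), (9, 72), (12, 98), (13, 95), (15, 71), (16, 59), (18, 101), (20, 96), (21,
   58), (22, 78), (23, 82), (24, 61), (25, 92), (27, 91), (28, 65), (29, 74), (30, 90), (32, 51),
   (33, 55), (34, 77), (35, 54), (38, 64), (39, 73), (40, 66), (41, 63), (42, 67), (44, 69), (45,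
   70), (47, 60), (48, 49), (52, 62)], [(43, 10, 46), (26, 11, 57), (14, 17, 19)]),
   ([(7, 99), (10, 91), (11, 110), (13, 81), (14, 98), (15, 64), (16, 60), (17, 50), (18, 62), (19,
   90), (20, 87), (22, 95), (23, 74), (24, 78), (25, 52), (26, 56), (28, 83), (29, 84), (30, 88),
   (31, 89), (32, 61), (33, 72), (34, 58), (35, 38), (36, 68), (37, 86), (39, 46), (40, 75), (45,
   51), (47, 69), (48, 55), (53, 66), (57, 65)], [(9, 12, 42), (8, 41, 59), (43, 27, 44)]),
   ([(7, 104), (9, 97), (10, 93), (12, 55), (14, 101), (15, 80), (16, 105), (17, 53), (18, 96),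
   (19, 65), (20, 46), (21, 88), (22, 77), (23, 85), (24, 74), (25, 56), (27, 51), (29, 91), (30,
   94), (31, 82), (32, 54), (33, 90), (35, 48), (37, 89), (38, 69), (40, 60), (41, 71), (43, 44),
   (45, 72), (49, 73), (50, 52), (57, 59), (58, 61), (62, 63)], [(34, 8, 68), (26, 13, 79), (11,
   36, 28)]),
   ([(7, 100), (8, 62), (9, 118), (11, 115), (12, 111), (13, 65), (14, 80), (17, 95), (18, 103),
   (19, 64), (20, 56), (21, 99), (22, 92), (23, 87), (24, 60), (27, 82), (28, 101), (30, 74), (31,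
   77), (32, 54), (33, 58), (34, 71), (35, 67), (36, 45), (37, 85), (38, 90), (39, 57), (41, 48),
   (43, 63), (44, 49), (47, 50), (51, 68), (52, 72), (55, 61), (59, 66)], [(29, 46, 42), (10, 16,
   53), (15, 25, 73)]),
   ([(7, 98), (8, 84), (9, 71), (10, 76), (11, 117), (12, 85), (15, 111), (16, 104), (18, 107),
   (20, 96), (21, 93), (22, 91), (23, 37), (24, 46), (26, 39), (27, 42), (28, 66), (31, 87), (32,
   56), (33, 68), (34, 75), (35, 55), (36, 64), (38, 83), (40, 62), (41, 89), (45, 63), (47, 59),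
   (48, 67), (49, 50), (51, 72), (52, 77), (53, 79), (54, 73), (57, 74), (58, 61)], [(17, 13, 82),
   (14, 29, 81), (19, 25, 78)]),
   ([(7, 90), (8, 94), (9, 119), (10, 106), (12, 73), (13, 68), (14, 113), (15, 95), (16, 45), (17,
   115), (18, 112), (19, 99), (20, 91), (22, 109), (24, 64), (26, 74), (28, 43), (29, 50), (30,
   104), (31, 70), (33, 53), (35, 98), (36, 57), (38, 67), (39, 82), (40, 80), (41, 66), (42, 84),
   (44, 78), (46, 83), (47, 49), (48, 77), (51, 72), (54, 63), (56, 58), (59, 65), (60, 75)], [(21,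
   55, 32), (27, 25, 37), (11, 23, 69)]),
   ([(7, 130), (8, 104), (9, 107), (10, 109), (11, 110), (12, 88), (13, 82), (14, 113), (15, 91),
   (18, 56), (19, 101), (20, 59), (21, 94), (22, 92), (23, 103), (24, 78), (25, 47), (26, 61), (29,
   69), (30, 105), (31, 93), (33, 51), (34, 37), (35, 54), (36, 96), (38, 73), (39, 41), (40, 83),
   (42, 57), (43, 75), (44, 46), (45, 52), (48, 77), (50, 86), (58, 70), (63, 68), (64, 65), (66,
   67)], [(16, 60, 62), (17, 32, 85), (27, 28, 53)]),
   ([(7, 77), (8, 74), (11, 128), (12, 98), (13, 121), (14, 105), (15, 93), (16, 114), (17, 112),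
   (18, 109), (19, 106), (20, 103), (21, 81), (22, 64), (24, 80), (25, 92), (26, 94), (28, 96),
   (29, 34), (30, 88), (31, 68), (33, 78), (37, 85), (38, 100), (39, 48), (40, 101), (42, 49), (43,
   89), (44, 51), (45, 52), (46, 70), (47, 60), (50, 83), (53, 62), (54, 72), (56, 57), (58, 79),
   (66, 69), (67, 73)], [(41, 35, 55), (61, 10, 65), (23, 9, 27)]),
   ([(7, 107), (8, 127), (10, 123), (12, 104), (14, 37), (15, 102), (16, 81), (17, 84), (18, 110),
   (19, 87), (23, 95), (24, 96), (25, 39), (26, 98), (28, 71), (29, 63), (31, 109), (32, 89), (33,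
   111), (34, 41), (35, 108), (36, 105), (38, 62), (40, 45), (42, 49), (44, 86), (46, 76), (47,
   66), (48, 78), (52, 90), (53, 83), (54, 80), (55, 77), (56, 82), (57, 72), (59, 60), (61, 70),
   (65, 74)], [(21, 67, 27), (20, 30, 43), (13, 9, 103), (58, 11, 68)]),
   ([(7, 140), (8, 73), (10, 107), (11, 90), (13, 98), (15, 128), (17, 99), (18, 87), (19, 118),
   (20, 124), (21, 104), (23, 97), (24, 79), (25, 67), (26, 113), (27, 94), (30, 78), (31, 95),
   (33, 109), (34, 68), (35, 110), (37, 85), (38, 96), (39, 80), (40, 75), (42, 93), (44, 89), (45,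
   91), (46, 60), (47, 84), (48, 66), (49, 83), (50, 62), (51, 76), (55, 86), (56, 82), (58, 65),
   (59, 70), (72, 74)], [(9, 32, 22), (14, 29, 28), (53, 16, 61), (12, 52, 36)]),
   ([(7, 116), (8, 95), (9, 93), (10, 126), (11, 74), (12, 133), (16, 128), (17, 125), (18, 129),
   (19, 80), (20, 118), (21, 110), (25, 37), (26, 104), (29, 106), (30, 60), (31, 101), (32, 65),
   (33, 61), (34, 71), (35, 89), (36, 98), (38, 46), (39, 82), (40, 75), (41, 78), (42, 108), (43,
   77), (44, 68), (45, 64), (49, 91), (50, 57), (51, 92), (53, 88), (54, 83), (55, 59), (56, 66),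
   (63, 86), (67, 79), (72, 76)], [(47, 22, 48), (28, 24, 87), (15, 58, 23), (14, 13, 100)]),
   ([(8, 145), (9, 141), (10, 89), (11, 114), (12, 116), (13, 121), (14, 130), (15, 127), (17, 92),
   (19, 113), (20, 53), (22, 111), (26, 80), (27, 57), (28, 123), (29, 69), (30, 78), (31, 107),
   (32, 97), (33, 93), (34, 71), (35, 87), (36, 82), (37, 103), (38, 79), (39, 47), (40, 112), (42,
   68), (43, 76), (44, 52), (46, 54), (48, 88), (49, 55), (50, 51), (58, 91), (59, 61), (60, 75),
   (62, 81), (63, 85), (65, 66), (67, 70)], [(7, 18, 77), (24, 21, 94), (56, 16, 74), (23, 41,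
   83)]),
   ([(7, 149), (9, 85), (11, 107), (12, 80), (13, 77), (14, 140), (15, 25), (16, 86), (18, 126),
   (19, 31), (20, 132), (21, 112), (22, 128), (23, 88), (24, 123), (26, 83), (28, 115), (29, 113),
   (30, 76), (33, 84), (35, 101), (36, 98), (37, 100), (38, 97), (39, 71), (41, 114), (42, 99),
   (44, 81), (46, 73), (47, 82), (49, 59), (51, 87), (52, 68), (53, 63), (54, 91), (55, 67), (56,
   74), (57, 89), (58, 66), (62, 65), (70, 78), (72, 79)], [(43, 32, 64), (10, 17, 104), (8, 61,
   34), (48, 45, 60)]),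
   ([(9, 150), (11, 147), (12, 118), (13, 144), (14, 129), (15, 124), (16, 137), (17, 121), (18,
   131), (20, 135), (21, 93), (22, 94), (25, 117), (26, 85), (27, 113), (28, 104), (30, 75), (31,
   78), (32, 102), (33, 95), (34, 74), (35, 65), (36, 87), (37, 52), (38, 82), (39, 59), (41, 62),
   (42, 80), (43, 63), (45, 70), (46, 81), (49, 99), (50, 57), (53, 83), (54, 97), (55, 71), (56,
   90), (58, 67), (60, 96), (64, 77), (66, 88), (69, 76), (73, 79)], [(8, 40, 44), (10, 19, 72),
   (7, 61, 51), (23, 24, 86)]),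
   ([(7, 133), (8, 126), (11, 136), (12, 115), (13, 108), (14, 131), (15, 141), (16, 90), (20,
   130), (21, 86), (24, 100), (25, 78), (28, 109), (29, 85), (30, 95), (31, 112), (32, 96), (33,
   119), (35, 88), (37, 81), (41, 53), (42, 102), (43, 56), (44, 61), (45, 117), (46, 111), (47,
   113), (48, 87), (49, 93), (50, 72), (51, 65), (52, 101), (54, 104), (55, 74), (58, 91), (59,
   73), (62, 92), (63, 76), (64, 97), (66, 89), (67, 79), (68, 70), (69, 82), (75, 84)], [(38, 39,
   71), (23, 34, 26), (9, 10, 17), (22, 18, 80)]),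
   ([(7, 149), (8, 145), (9, 106), (10, 128), (12, 75), (13, 129), (14, 140), (17, 99), (18, 83),
   (19, 124), (20, 111), (21, 98), (24, 85), (25, 121), (28, 56), (29, 123), (30, 107), (32, 100),
   (33, 103), (34, 93), (36, 86), (38, 117), (39, 125), (40, 118), (41, 94), (42, 102), (43, 54),
   (44, 113), (45, 69), (47, 73), (48, 78), (50, 62), (51, 57), (52, 96), (55, 79), (58, 105), (59,
   82), (60, 91), (61, 89), (64, 66), (65, 95), (70, 92), (71, 76), (77, 88), (80, 81)], [(15, 31,
   22), (35, 37, 67), (16, 11, 63), (26, 23, 110)]),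
   ([(7, 119), (8, 82), (10, 121), (12, 104), (13, 94), (14, 100), (15, 143), (17, 128), (18, 93),
   (19, 98), (20, 124), (21, 44), (22, 120), (24, 105), (25, 108), (26, 112), (28, 140), (29, 125),
   (30, 127), (31, 68), (32, 130), (33, 113), (36, 49), (37, 110), (40, 109), (41, 42), (45, 122),
   (46, 115), (47, 89), (51, 102), (52, 80), (54, 87), (55, 63), (56, 96), (57, 103), (58, 79),
   (59, 75), (60, 91), (61, 78), (62, 101), (64, 92), (66, 69), (67, 97), (70, 95), (72, 76), (74,
   81)], [(11, 23, 50), (9, 39, 38), (16, 27, 123), (53, 35, 71)]),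
   ([(7, 92), (9, 121), (11, 145), (13, 116), (14, 138), (16, 137), (19, 114), (20, 135), (21, 86),
   (23, 125), (24, 117), (25, 90), (27, 143), (28, 69), (29, 79), (30, 139), (32, 94), (33, 128),
   (35, 101), (37, 113), (38, 84), (39, 123), (40, 106), (41, 93), (45, 75), (46, 73), (47, 71),
   (49, 55), (50, 110), (51, 98), (52, 95), (53, 59), (54, 88), (56, 103), (57, 70), (58, 105),
   (60, 111), (61, 96), (62, 89), (63, 102), (64, 100), (65, 66), (68, 72), (76, 78), (77, 81),
   (80, 87), (83, 85)], [(15, 67, 42), (22, 12, 132), (8, 10, 26), (17, 31, 43)]),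
   ([(9, 94), (10, 87), (11, 143), (12, 122), (13, 114), (14, 136), (15, 147), (16, 93), (17, 95),
   (18, 138), (20, 153), (21, 130), (22, 149), (23, 116), (24, 118), (25, 123), (26, 81), (28,
   129), (29, 140), (30, 59), (31, 141), (32, 88), (33, 100), (34, 124), (36, 50), (37, 71), (38,
   132), (39, 113), (41, 80), (43, 125), (44, 62), (45, 92), (46, 115), (47, 72), (48, 111), (49,
   96), (51, 84), (52, 79), (53, 57), (54, 74), (58, 105), (60, 66), (64, 102), (65, 99), (68, 78),
   (70, 85), (73, 101), (82, 83)], [(40, 27, 77), (8, 55, 35), (7, 69, 91), (42, 19, 56)]),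
   ([(7, 125), (8, 107), (9, 83), (10, 146), (11, 117), (12, 160), (13, 86), (14, 32), (15, 155),
   (16, 143), (17, 130), (19, 138), (20, 154), (21, 123), (22, 68), (23, 81), (24, 87), (25, 127),
   (26, 119), (27, 110), (29, 113), (30, 72), (31, 136), (33, 96), (34, 66), (35, 89), (36, 38),
   (41, 93), (42, 97), (43, 121), (44, 131), (45, 50), (47, 118), (48, 58), (51, 84), (52, 98),
   (53, 67), (54, 112), (55, 122), (56, 85), (59, 103), (62, 109), (63, 105), (64, 69), (65, 108),
   (70, 91), (71, 78), (73, 80), (76, 82)], [(37, 77, 49), (18, 57, 94), (28, 88, 60), (39, 40,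
   61)]),
   ([(7, 125), (11, 157), (12, 105), (13, 19), (15, 150), (16, 124), (18, 134), (20, 151), (21,
   126), (22, 67), (23, 98), (24, 61), (25, 108), (26, 116), (27, 31), (28, 118), (29, 131), (30,
   128), (33, 115), (34, 139), (36, 78), (37, 99), (39, 127), (40, 70), (41, 96), (42, 112), (43,
   59), (44, 75), (45, 104), (46, 83), (48, 130), (49, 71), (50, 106), (51, 92), (52, 111), (53,
   60), (56, 103), (62, 79), (63, 101), (64, 91), (65, 107), (66, 72), (69, 76), (74, 93), (77,
   100), (80, 82), (81, 95), (84, 90), (86, 94), (87, 88)], [(35, 38, 97), (14, 54, 55), (8, 9,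
   144), (10, 47, 122)]),
   ([(8, 57), (9, 119), (10, 100), (11, 146), (12, 167), (13, 131), (14, 140), (15, 96), (16, 71),
   (17, 84), (18, 75), (19, 145), (22, 139), (26, 137), (27, 143), (29, 124), (30, 88), (31, 129),
   (32, 151), (33, 148), (34, 108), (35, 136), (36, 114), (37, 85), (38, 69), (39, 113), (40, 62),
   (41, 115), (42, 105), (43, 134), (45, 135), (46, 66), (47, 73), (48, 126), (49, 68), (50, 80),
   (51, 70), (52, 116), (53, 56), (54, 79), (55, 123), (58, 91), (59, 106), (60, 67), (61, 98),
   (64, 94), (72, 83), (77, 92), (81, 95), (82, 90), (86, 89)], [(7, 21, 104), (74, 23, 76), (20,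
   24, 138), (25, 78, 63)]),
   ([(7, 82), (8, 154), (9, 149), (10, 28), (11, 21), (12, 115), (13, 148), (14, 110), (15, 151),
   (16, 126), (17, 150), (18, 27), (19, 145), (20, 133), (22, 147), (23, 140), (24, 156), (25,
   103), (29, 143), (31, 98), (33, 105), (34, 97), (36, 94), (39, 120), (41, 100), (42, 93), (43,
   134), (44, 108), (47, 78), (48, 107), (49, 52), (50, 121), (51, 61), (54, 85), (55, 118), (58,
   74), (59, 117), (60, 123), (62, 75), (64, 96), (65, 81), (66, 70), (67, 90), (68, 116), (69,
   109), (71, 111), (72, 113), (73, 95), (76, 99), (80, 106), (83, 91), (84, 86)], [(46, 56, 63),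
   (37, 40, 104), (26, 53, 35), (57, 30, 92)]),
   ([(7, 128), (8, 161), (9, 122), (11, 159), (13, 163), (14, 120), (15, 23), (17, 171), (18, 114),
   (20, 140), (21, 154), (22, 127), (24, 112), (25, 158), (27, 56), (29, 121), (30, 125), (31,
   102), (32, 146), (33, 144), (34, 152), (36, 130), (37, 105), (40, 48), (41, 110), (42, 81), (45,
   139), (46, 141), (47, 101), (49, 104), (50, 53), (51, 73), (52, 137), (54, 57), (55, 62), (58,
   98), (59, 126), (60, 87), (61, 107), (63, 99), (64, 100), (65, 116), (66, 91), (67, 78), (68,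
   75), (71, 109), (72, 93), (77, 97), (80, 92), (82, 85), (84, 95)], [(10, 76, 43), (12, 16, 90),
   (19, 70, 26), (69, 39, 74), (35, 44, 94)]),
   ([(7, 99), (8, 182), (9, 92), (10, 178), (11, 175), (12, 151), (13, 102), (14, 126), (15, 155),
   (16, 144), (18, 107), (20, 132), (21, 96), (22, 158), (23, 134), (24, 95), (25, 103), (26, 141),
   (27, 135), (28, 143), (30, 154), (31, 148), (32, 124), (34, 139), (35, 78), (37, 150), (40, 49),
   (41, 82), (42, 72), (43, 146), (45, 86), (46, 58), (47, 118), (48, 61), (51, 121), (52, 122),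
   (53, 94), (54, 88), (56, 136), (57, 76), (59, 105), (60, 108), (62, 129), (66, 87), (68, 69),
   (70, 75), (71, 98), (73, 110), (74, 85), (80, 81), (84, 93), (90, 91)], [(36, 29, 120), (39, 77,
   50), (38, 17, 83), (64, 33, 79), (19, 44, 67)]),
   ([(8, 105), (9, 106), (10, 138), (11, 153), (12, 160), (15, 107), (17, 171), (18, 163), (20,
   62), (21, 144), (22, 156), (23, 154), (24, 159), (26, 132), (27, 141), (29, 157), (30, 66), (31,
   121), (32, 137), (33, 143), (34, 146), (35, 104), (36, 89), (37, 54), (38, 128), (39, 78), (40,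
   142), (43, 151), (44, 135), (45, 100), (46, 109), (47, 87), (48, 75), (49, 77), (51, 124), (52,
   97), (53, 136), (55, 63), (57, 93), (58, 112), (59, 131), (60, 67), (64, 65), (68, 99), (70,
   103), (71, 116), (72, 119), (73, 74), (76, 108), (79, 83), (81, 114), (86, 88), (92, 101)], [(7,
   95, 90), (28, 13, 120), (42, 14, 84), (19, 61, 50), (16, 69, 25)]),
   ([(7, 115), (8, 189), (9, 118), (11, 185), (12, 166), (13, 152), (15, 89), (16, 130), (18, 46),
   (19, 172), (20, 103), (21, 49), (22, 47), (24, 138), (25, 168), (27, 132), (28, 135), (29, 102),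
   (30, 76), (31, 145), (32, 96), (35, 142), (36, 154), (37, 84), (38, 105), (39, 110), (40, 111),
   (41, 117), (42, 114), (43, 136), (44, 139), (50, 100), (51, 133), (52, 140), (53, 141), (54,
   116), (55, 93), (56, 125), (57, 129), (60, 95), (61, 83), (63, 119), (65, 109), (68, 107), (71,
   98), (72, 85), (73, 80), (74, 90), (78, 120), (79, 101), (82, 113), (86, 87), (88, 99), (91,
   97)], [(33, 26, 108), (10, 67, 94), (45, 17, 75), (23, 58, 66), (34, 14, 112)]),
   ([(7, 155), (8, 140), (9, 127), (10, 149), (11, 181), (12, 167), (13, 147), (15, 180), (16, 46),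
   (17, 154), (18, 173), (19, 38), (21, 112), (22, 119), (23, 134), (24, 26), (25, 172), (28, 146),
   (29, 161), (30, 109), (31, 114), (32, 49), (34, 117), (36, 132), (40, 124), (42, 111), (43,
   135), (44, 142), (45, 120), (47, 116), (48, 56), (52, 71), (53, 129), (58, 131), (60, 90), (61,
   65), (63, 80), (67, 118), (68, 115), (69, 125), (70, 128), (72, 94), (73, 83), (74, 96), (75,
   101), (76, 108), (77, 122), (78, 99), (79, 121), (84, 85), (86, 89), (87, 106), (88, 100), (91,
   110), (92, 95)], [(39, 59, 54), (35, 20, 82), (14, 37, 107), (33, 64, 41), (66, 27, 103)]),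
   ([(8, 126), (9, 131), (10, 191), (11, 148), (12, 165), (14, 185), (15, 183), (16, 181), (18,
   117), (19, 139), (20, 167), (21, 168), (23, 129), (24, 162), (27, 133), (28, 115), (29, 99),
   (30, 93), (31, 145), (32, 164), (33, 81), (34, 138), (37, 88), (38, 74), (41, 95), (42, 150),
   (43, 120), (45, 116), (46, 86), (47, 141), (48, 118), (49, 146), (50, 105), (51, 103), (52,
   122), (53, 137), (56, 144), (58, 84), (59, 119), (61, 110), (63, 64), (65, 92), (67, 113), (68,
   111), (70, 100), (71, 78), (72, 130), (73, 102), (75, 76), (77, 79), (80, 124), (82, 91), (87,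
   107), (89, 104), (90, 94), (97, 106)], [(25, 60, 36), (13, 22, 147), (7, 62, 39), (44, 54, 55),
   (17, 40, 26)]),
   ([(7, 181), (8, 118), (9, 170), (11, 142), (13, 163), (14, 183), (15, 78), (16, 100), (18, 189),
   (19, 133), (20, 97), (22, 113), (23, 114), (24, 131), (26, 158), (27, 98), (28, 168), (29, 146),
   (30, 171), (32, 73), (33, 89), (34, 156), (35, 88), (36, 150), (37, 127), (38, 82), (39, 160),
   (40, 132), (41, 151), (42, 145), (45, 121), (46, 148), (47, 157), (48, 147), (51, 140), (52,
   128), (53, 149), (54, 107), (55, 130), (56, 106), (57, 79), (58, 61), (59, 144), (63, 76), (64,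
   90), (67, 115), (68, 138), (69, 124), (70, 71), (74, 104), (75, 92), (80, 85), (81, 96), (83,
   86), (87, 111), (95, 110), (99, 101)], [(25, 84, 50), (49, 17, 77), (44, 21, 108), (12, 31, 60),
   (62, 10, 102)]),
   ([(7, 147), (9, 188), (10, 68), (11, 65), (12, 193), (14, 50), (15, 123), (17, 182), (18, 140),
   (19, 87), (20, 176), (21, 135), (22, 170), (24, 167), (25, 164), (26, 160), (27, 118), (28,
   152), (29, 149), (30, 132), (31, 144), (34, 166), (36, 112), (37, 113), (38, 125), (39, 120),
   (40, 77), (41, 127), (43, 122), (44, 99), (45, 52), (47, 114), (48, 94), (49, 82), (51, 73),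
   (53, 137), (56, 90), (57, 100), (59, 151), (60, 70), (61, 72), (62, 136), (63, 139), (66, 111),
   (67, 105), (69, 126), (74, 81), (75, 104), (83, 101), (84, 89), (85, 121), (86, 108), (88, 119),
   (91, 92), (93, 116), (95, 109), (96, 107), (98, 103)], [(16, 42, 129), (33, 13, 128), (23, 32,
   153), (71, 8, 102), (35, 80, 54)]),
   ([(7, 167), (8, 77), (9, 96), (10, 156), (11, 169), (12, 16), (13, 185), (15, 195), (17, 173),
   (18, 181), (19, 164), (20, 176), (21, 151), (22, 116), (23, 186), (25, 182), (26, 132), (27,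
   127), (30, 159), (31, 124), (33, 130), (34, 109), (35, 140), (36, 103), (37, 97), (38, 110),
   (39, 123), (40, 66), (41, 81), (42, 73), (43, 144), (44, 126), (45, 146), (46, 119), (47, 150),
   (48, 113), (50, 102), (51, 70), (52, 55), (53, 153), (54, 75), (56, 79), (57, 114), (59, 118),
   (60, 142), (64, 149), (65, 82), (68, 136), (69, 99), (71, 86), (72, 133), (74, 137), (80, 104),
   (84, 128), (88, 90), (89, 111), (93, 108), (94, 100), (95, 98)], [(63, 49, 76), (58, 62, 83),
   (32, 29, 131), (78, 14, 87), (67, 24, 117)]),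
   ([(8, 199), (9, 146), (10, 152), (11, 103), (12, 174), (13, 159), (14, 187), (15, 74), (16,
   125), (17, 151), (18, 165), (19, 184), (20, 194), (21, 185), (22, 112), (23, 90), (24, 176),
   (25, 132), (27, 137), (28, 169), (32, 180), (33, 102), (34, 171), (35, 108), (36, 175), (37,
   121), (38, 92), (39, 163), (40, 142), (41, 115), (43, 138), (44, 144), (45, 105), (46, 149),
   (48, 80), (51, 88), (52, 75), (53, 78), (55, 160), (56, 98), (57, 59), (58, 68), (60, 62), (63,
   84), (64, 72), (65, 145), (66, 104), (67, 123), (69, 129), (70, 119), (73, 94), (76, 140), (77,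
   100), (81, 110), (83, 109), (85, 124), (86, 87), (93, 120), (95, 101), (96, 97)], [(42, 49,
   117), (26, 107, 71), (31, 30, 118), (50, 29, 82), (47, 7, 99)]),
   ([(7, 15), (8, 138), (9, 197), (10, 160), (11, 185), (12, 154), (13, 49), (14, 144), (16, 163),
   (18, 190), (19, 167), (20, 34), (21, 161), (24, 157), (25, 126), (28, 31), (30, 174), (32, 178),
   (33, 155), (35, 142), (36, 129), (37, 136), (38, 162), (39, 150), (42, 117), (43, 125), (44,
   83), (47, 148), (50, 149), (51, 70), (52, 112), (55, 120), (56, 115), (57, 67), (60, 63), (61,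
   78), (64, 119), (65, 75), (66, 135), (68, 141), (69, 134), (72, 84), (74, 137), (76, 77), (79,
   133), (80, 122), (81, 132), (85, 102), (86, 130), (87, 111), (88, 92), (89, 128), (91, 93), (94,
   100), (95, 110), (96, 97), (98, 109), (101, 113), (103, 116), (104, 114), (107, 108)], [(41, 58,
   48), (46, 27, 118), (23, 17, 152), (29, 53, 90), (45, 26, 105)]),
   ([(7, 154), (8, 119), (9, 175), (12, 52), (13, 150), (14, 155), (16, 32), (17, 165), (18, 62),
   (19, 141), (20, 156), (21, 37), (23, 45), (24, 174), (26, 195), (27, 135), (28, 54), (29, 152),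
   (30, 136), (31, 148), (34, 146), (35, 177), (38, 158), (41, 149), (43, 142), (44, 129), (46,
   125), (47, 140), (49, 145), (50, 133), (51, 151), (56, 81), (57, 131), (59, 105), (60, 144),
   (63, 123), (65, 153), (66, 126), (70, 100), (73, 124), (74, 143), (75, 134), (76, 138), (77,
   122), (78, 113), (79, 110), (83, 84), (85, 115), (86, 130), (87, 116), (89, 104), (90, 117),
   (92, 109), (93, 120), (94, 128), (95, 111), (96, 112), (97, 114), (99, 121), (101, 118), (102,
   103), (107, 108)], [(22, 33, 36), (42, 11, 157), (25, 15, 132), (39, 67, 72), (61, 10, 88)]),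
   ([(7, 188), (9, 200), (10, 155), (11, 204), (12, 124), (13, 192), (14, 121), (15, 126), (17,
   122), (19, 202), (20, 129), (23, 152), (25, 169), (26, 171), (27, 189), (28, 103), (29, 31),
   (32, 111), (33, 147), (34, 164), (35, 83), (36, 176), (37, 108), (38, 134), (40, 119), (41,
   137), (42, 50), (43, 156), (46, 157), (47, 57), (49, 101), (51, 162), (52, 125), (53, 166), (54,
   132), (55, 163), (56, 114), (58, 109), (59, 123), (61, 161), (62, 146), (64, 115), (66, 151),
   (67, 153), (68, 74), (70, 144), (71, 77), (72, 138), (73, 128), (75, 98), (76, 120), (78, 82),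
   (79, 127), (81, 93), (84, 100), (85, 102), (86, 99), (90, 91), (94, 130), (96, 97), (105, 106),
   (107, 116), (112, 113)], [(22, 88, 80), (21, 44, 89), (30, 39, 48), (16, 8, 183), (18, 45, 95)]),
   ([(8, 219), (9, 179), (10, 218), (11, 210), (12, 139), (13, 211), (14, 126), (15, 192), (16,
   174), (18, 197), (19, 131), (20, 196), (21, 128), (22, 99), (23, 182), (24, 143), (25, 184),
   (26, 176), (28, 157), (29, 169), (30, 164), (32, 113), (33, 160), (35, 148), (36, 153), (37,
   93), (39, 142), (40, 146), (43, 135), (44, 85), (45, 156), (47, 112), (48, 86), (49, 171), (50,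
   122), (51, 82), (52, 162), (53, 117), (54, 55), (56, 71), (57, 106), (59, 107), (60, 165), (61,
   114), (62, 92), (63, 95), (64, 144), (65, 138), (67, 124), (68, 84), (70, 103), (72, 96), (74,
   87), (76, 136), (77, 78), (80, 100), (81, 141), (83, 123), (88, 111), (89, 115), (90, 97), (94,
   132), (98, 102), (101, 116)], [(58, 17, 120), (7, 27, 91), (66, 42, 105), (46, 73, 104), (31,
   38, 41)]),
   ([(8, 206), (9, 192), (10, 186), (11, 158), (12, 183), (13, 210), (14, 180), (16, 215), (17,
   205), (18, 207), (19, 120), (20, 208), (23, 181), (24, 165), (25, 166), (26, 110), (27, 116),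
   (28, 124), (29, 190), (30, 188), (31, 128), (32, 113), (33, 101), (34, 121), (35, 177), (36,
   126), (37, 161), (38, 112), (39, 146), (40, 176), (42, 157), (43, 135), (45, 137), (46, 54),
   (47, 153), (49, 78), (50, 118), (51, 170), (52, 77), (53, 114), (55, 96), (56, 123), (57, 117),
   (58, 115), (59, 125), (60, 81), (61, 163), (63, 97), (65, 122), (69, 144), (70, 94), (71, 85),
   (72, 148), (73, 76), (74, 98), (75, 142), (79, 147), (82, 111), (83, 88), (84, 119), (91, 138),
   (93, 109), (95, 132), (103, 108), (104, 105)], [(90, 41, 99), (48, 44, 62), (68, 21, 86), (64,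
   66, 67), (15, 7, 80)]),
   ([(9, 90), (10, 214), (13, 185), (14, 199), (15, 216), (16, 127), (18, 205), (19, 188), (21,
   153), (22, 172), (24, 114), (25, 196), (26, 182), (27, 154), (28, 118), (29, 183), (33, 178),
   (35, 156), (37, 104), (38, 168), (39, 163), (40, 193), (41, 119), (42, 134), (43, 101), (45,
   187), (46, 149), (47, 85), (49, 77), (50, 140), (52, 157), (53, 133), (54, 108), (55, 120), (56,
   121), (57, 123), (58, 67), (59, 159), (60, 170), (61, 139), (62, 148), (63, 102), (64, 151),
   (66, 161), (69, 73), (70, 164), (71, 84), (72, 94), (74, 110), (75, 117), (76, 128), (78, 150),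
   (79, 122), (81, 92), (82, 97), (83, 88), (87, 135), (89, 130), (91, 106), (95, 131), (98, 105),
   (100, 129), (109, 111), (112, 113)], [(86, 7, 96), (31, 20, 116), (8, 107, 30), (48, 17, 152),
   (12, 32, 36), (11, 23, 124)]),
   ([(7, 228), (8, 138), (9, 196), (10, 126), (11, 111), (13, 115), (14, 203), (16, 216), (17,
   210), (19, 212), (22, 202), (23, 163), (24, 198), (25, 208), (26, 139), (27, 137), (28, 140),
   (30, 160), (31, 161), (32, 183), (33, 68), (34, 151), (35, 201), (37, 95), (38, 133), (39, 195),
   (40, 181), (41, 106), (42, 149), (43, 105), (44, 85), (47, 162), (48, 130), (49, 174), (51,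
   108), (52, 166), (53, 92), (54, 102), (55, 121), (57, 110), (59, 141), (61, 143), (62, 175),
   (63, 119), (66, 69), (70, 123), (71, 158), (72, 134), (73, 124), (74, 120), (75, 109), (76,
   150), (77, 103), (78, 91), (79, 98), (80, 99), (81, 144), (82, 107), (84, 104), (86, 125), (87,
   127), (89, 118), (93, 94), (100, 113), (114, 116)], [(12, 46, 96), (18, 65, 90), (15, 45, 112),
   (36, 20, 97), (21, 29, 170), (67, 64, 88)]),
   ([(7, 146), (8, 151), (9, 164), (10, 31), (11, 111), (12, 223), (13, 221), (14, 188), (16, 129),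
   (17, 209), (18, 197), (20, 186), (21, 195), (22, 198), (23, 196), (24, 193), (27, 117), (28,
   185), (29, 181), (30, 182), (32, 175), (34, 171), (35, 149), (36, 141), (37, 166), (39, 190),
   (40, 187), (42, 95), (43, 83), (44, 72), (45, 156), (46, 75), (47, 133), (48, 135), (49, 130),
   (51, 125), (53, 138), (54, 115), (56, 63), (57, 91), (58, 103), (61, 93), (62, 101), (64, 106),
   (65, 160), (66, 77), (67, 88), (68, 100), (69, 131), (70, 97), (71, 147), (73, 99), (76, 152),
   (78, 162), (79, 157), (80, 128), (81, 158), (82, 92), (85, 104), (87, 150), (90, 134), (96,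
   142), (107, 124), (108, 114), (110, 123), (112, 120)], [(33, 19, 113), (84, 25, 102), (55, 50,
   89), (26, 60, 118), (38, 98, 94), (15, 59, 140)]),
   ([(7, 162), (8, 140), (9, 206), (10, 230), (11, 100), (13, 136), (14, 223), (17, 121), (18,
   211), (19, 154), (20, 214), (22, 205), (23, 203), (25, 199), (26, 196), (27, 194), (29, 102),
   (30, 189), (31, 186), (32, 176), (33, 183), (34, 74), (35, 198), (36, 174), (37, 158), (38,
   115), (41, 168), (43, 159), (45, 99), (46, 124), (47, 83), (48, 165), (49, 139), (50, 110), (51,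
   92), (52, 191), (53, 178), (54, 73), (55, 82), (56, 164), (57, 84), (59, 128), (60, 152), (61,
   105), (62, 163), (64, 87), (66, 135), (67, 171), (69, 123), (70, 112), (71, 129), (72, 125),
   (76, 156), (77, 113), (78, 97), (79, 101), (80, 161), (81, 155), (85, 150), (86, 107), (88, 93),
   (89, 90), (94, 134), (95, 147), (96, 122), (98, 106), (119, 120)], [(44, 65, 68), (75, 16, 116),
   (28, 117, 40), (12, 114, 58), (24, 15, 103), (21, 42, 104)]),
   ([(7, 51), (8, 141), (9, 234), (10, 187), (11, 203), (13, 191), (14, 224), (15, 221), (17, 153),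
   (19, 222), (21, 105), (22, 207), (25, 156), (26, 200), (27, 198), (28, 195), (29, 130), (30,
   190), (31, 121), (32, 185), (33, 140), (34, 145), (35, 119), (37, 175), (38, 131), (41, 174),
   (42, 163), (44, 93), (45, 157), (46, 164), (48, 90), (49, 186), (50, 98), (52, 142), (53, 192),
   (54, 97), (55, 134), (56, 184), (57, 171), (59, 88), (60, 133), (61, 106), (62, 180), (64, 72),
   (65, 162), (66, 95), (67, 165), (68, 178), (69, 144), (70, 76), (71, 125), (73, 160), (74, 103),
   (75, 155), (77, 99), (79, 109), (80, 139), (81, 91), (82, 101), (84, 115), (85, 123), (87, 114),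
   (89, 150), (94, 124), (100, 116), (102, 107), (108, 129), (113, 118)], [(12, 92, 18), (43, 40,
   128), (20, 16, 96), (78, 39, 127), (63, 23, 120), (24, 111, 47)]),
   ([(7, 242), (8, 154), (9, 238), (10, 236), (11, 166), (13, 31), (16, 169), (17, 210), (18, 187),
   (19, 142), (20, 217), (21, 211), (22, 149), (23, 106), (24, 115), (26, 104), (27, 128), (28,
   158), (29, 165), (30, 58), (34, 182), (35, 190), (38, 201), (39, 179), (41, 79), (42, 138), (43,
   152), (45, 168), (46, 197), (47, 159), (49, 174), (50, 68), (51, 164), (52, 136), (53, 175),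
   (54, 167), (56, 140), (57, 127), (60, 84), (61, 173), (63, 178), (64, 150), (66, 163), (67,
   137), (71, 141), (72, 117), (73, 125), (74, 146), (75, 156), (76, 105), (77, 123), (78, 82),
   (80, 90), (81, 112), (83, 109), (86, 147), (87, 148), (89, 94), (92, 134), (93, 116), (96, 103),
   (98, 132), (99, 108), (100, 145), (101, 102), (110, 114), (113, 131), (119, 121), (122, 126)],
   [(36, 12, 85), (62, 33, 124), (14, 55, 153), (37, 70, 65), (59, 32, 111), (15, 25, 151)]),
   ([(7, 136), (8, 199), (9, 192), (10, 229), (12, 119), (13, 191), (14, 115), (16, 217), (17,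
   124), (18, 234), (19, 193), (20, 198), (21, 203), (22, 154), (24, 197), (25, 186), (26, 126),
   (27, 163), (28, 182), (29, 171), (30, 195), (33, 114), (34, 98), (36, 206), (38, 167), (40,
   135), (41, 172), (42, 104), (43, 180), (44, 165), (45, 121), (46, 59), (47, 130), (48, 65), (49,
   140), (50, 158), (52, 174), (54, 196), (55, 161), (56, 184), (57, 128), (58, 157), (60, 178),
   (63, 156), (64, 183), (66, 76), (67, 155), (71, 170), (72, 81), (75, 145), (77, 159), (80, 108),
   (82, 169), (83, 90), (84, 97), (85, 150), (86, 101), (87, 144), (89, 125), (92, 151), (94, 138),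
   (95, 99), (96, 148), (100, 102), (103, 134), (110, 117), (111, 137), (112, 118), (116, 133),
   (122, 123)], [(78, 61, 107), (35, 74, 53), (23, 39, 31), (32, 37, 51), (68, 11, 149), (15, 91,
   73)]),
   ([(7, 237), (8, 233), (9, 144), (11, 26), (12, 181), (13, 164), (14, 238), (16, 198), (17, 57),
   (18, 195), (19, 236), (20, 141), (21, 210), (22, 202), (23, 174), (27, 139), (29, 188), (30,
   205), (32, 140), (33, 154), (34, 216), (35, 156), (36, 203), (39, 180), (40, 207), (41, 127),
   (42, 109), (43, 179), (44, 157), (45, 84), (47, 149), (48, 170), (49, 143), (50, 184), (51,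
   116), (52, 190), (53, 159), (54, 173), (56, 107), (58, 171), (59, 110), (60, 76), (61, 145),
   (62, 132), (64, 66), (67, 186), (68, 155), (69, 114), (71, 178), (73, 85), (75, 146), (77, 134),
   (79, 81), (83, 162), (86, 99), (87, 88), (90, 92), (91, 108), (93, 133), (96, 124), (97, 112),
   (98, 142), (101, 103), (102, 106), (104, 147), (105, 123), (111, 119), (113, 135), (115, 117),
   (120, 126), (121, 122)], [(94, 31, 100), (63, 15, 137), (65, 24, 165), (55, 25, 70), (28, 10,
   138), (72, 46, 82)]),
   ([(7, 250), (9, 247), (10, 136), (12, 242), (13, 232), (15, 115), (16, 174), (17, 210), (18,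
   234), (20, 179), (21, 122), (22, 173), (23, 226), (24, 120), (25, 171), (26, 176), (27, 185),
   (28, 203), (29, 222), (30, 193), (31, 150), (32, 89), (33, 192), (35, 189), (36, 113), (38,
   191), (39, 178), (40, 135), (41, 197), (43, 187), (44, 170), (46, 95), (47, 112), (48, 165),
   (49, 162), (51, 177), (52, 134), (53, 156), (54, 98), (55, 151), (57, 180), (58, 160), (59,
   148), (60, 155), (61, 107), (62, 184), (63, 100), (65, 123), (67, 94), (68, 101), (69, 85), (70,
   96), (71, 74), (72, 111), (73, 84), (75, 164), (76, 172), (78, 158), (80, 102), (81, 119), (83,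
   118), (88, 147), (90, 126), (92, 129), (93, 140), (97, 108), (103, 105), (106, 137), (109, 131),
   (114, 139), (117, 124), (127, 128)], [(82, 34, 104), (45, 87, 66), (77, 56, 86), (14, 50, 194),
   (11, 8, 91), (37, 42, 125)]),
   ([(9, 125), (11, 238), (12, 235), (13, 231), (14, 196), (15, 213), (16, 218), (17, 233), (18,
   236), (19, 163), (20, 189), (21, 112), (22, 124), (23, 169), (24, 164), (25, 153), (27, 160),
   (28, 225), (29, 227), (30, 222), (31, 184), (32, 229), (34, 212), (35, 165), (36, 37), (39,
   147), (40, 219), (41, 127), (42, 161), (43, 150), (44, 180), (45, 131), (46, 106), (47, 130),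
   (48, 143), (50, 201), (51, 148), (52, 162), (53, 167), (54, 141), (55, 149), (56, 181), (59,
   114), (60, 179), (62, 64), (65, 132), (66, 128), (69, 174), (70, 135), (71, 104), (72, 139),
   (74, 116), (75, 91), (76, 79), (77, 81), (80, 136), (82, 90), (83, 119), (84, 157), (85, 170),
   (86, 121), (88, 120), (89, 151), (97, 145), (98, 100), (99, 107), (102, 156), (103, 142), (108,
   140), (109, 117), (110, 111), (113, 144), (123, 137)], [(8, 49, 38), (67, 26, 92), (7, 122,
   101), (61, 33, 138), (68, 10, 105), (58, 96, 63)]),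
   ([(7, 250), (8, 248), (9, 255), (10, 252), (12, 242), (13, 233), (16, 244), (17, 236), (18,
   219), (19, 160), (21, 173), (22, 223), (23, 24), (25, 178), (27, 224), (28, 177), (29, 166),
   (30, 117), (31, 167), (32, 196), (33, 181), (36, 125), (37, 71), (38, 202), (39, 103), (40,
   168), (41, 109), (42, 216), (44, 169), (45, 162), (48, 144), (50, 137), (51, 164), (52, 165),
   (53, 185), (54, 126), (55, 136), (56, 60), (57, 118), (59, 141), (61, 127), (63, 113), (64,
   120), (65, 145), (66, 163), (67, 174), (69, 151), (70, 155), (72, 85), (73, 158), (74, 82), (75,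
   78), (76, 83), (77, 134), (79, 122), (81, 140), (84, 138), (86, 149), (87, 143), (88, 146), (89,
   100), (90, 92), (91, 152), (93, 139), (94, 99), (95, 131), (96, 110), (98, 101), (102, 107),
   (106, 133), (112, 115), (119, 130), (123, 124), (128, 135)], [(35, 62, 121), (49, 80, 132), (14,
   20, 170), (11, 15, 171), (58, 46, 68), (105, 43, 111)]),
   ([(8, 255), (9, 118), (10, 158), (11, 206), (12, 189), (13, 233), (15, 215), (18, 176), (19,
   177), (20, 225), (21, 232), (22, 52), (23, 229), (24, 64), (25, 120), (26, 187), (27, 195), (28,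
   179), (29, 212), (32, 154), (33, 60), (34, 202), (35, 224), (36, 204), (37, 211), (38, 105),
   (39, 46), (40, 107), (41, 123), (42, 148), (43, 191), (44, 139), (45, 163), (47, 173), (48,
   219), (50, 210), (51, 102), (53, 184), (54, 115), (55, 150), (56, 171), (58, 160), (59, 185),
   (62, 97), (63, 92), (66, 165), (67, 136), (68, 146), (69, 140), (70, 128), (73, 99), (75, 113),
   (76, 174), (77, 116), (78, 119), (79, 121), (80, 181), (81, 170), (82, 161), (83, 152), (84,
   94), (86, 137), (87, 141), (89, 103), (90, 149), (91, 108), (98, 156), (100, 157), (104, 138),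
   (111, 151), (112, 114), (122, 144), (124, 134), (126, 130), (129, 135)], [(16, 117, 132), (31,
   30, 101), (17, 125, 96), (49, 57, 110), (65, 7, 175), (14, 95, 71)]),
   ([(7, 182), (9, 120), (10, 227), (13, 164), (14, 229), (15, 253), (16, 67), (18, 155), (19,
   192), (20, 99), (21, 249), (22, 134), (24, 224), (25, 209), (27, 196), (28, 167), (29, 221),
   (30, 206), (31, 135), (32, 203), (33, 218), (34, 212), (35, 180), (36, 226), (37, 148), (38,
   181), (39, 225), (40, 198), (41, 222), (42, 199), (43, 190), (44, 184), (45, 168), (46, 96),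
   (48, 97), (49, 139), (50, 208), (52, 200), (53, 187), (55, 95), (56, 151), (57, 159), (58, 112),
   (59, 138), (60, 116), (61, 183), (62, 131), (63, 128), (64, 76), (65, 78), (68, 171), (70, 160),
   (71, 91), (72, 74), (73, 169), (75, 111), (79, 93), (80, 152), (81, 178), (82, 163), (86, 108),
   (87, 174), (88, 122), (89, 158), (94, 175), (98, 104), (103, 117), (105, 109), (106, 154), (107,
   124), (110, 157), (118, 136), (121, 144), (123, 133), (125, 141), (127, 130)], [(26, 66, 113),
   (8, 69, 84), (85, 17, 115), (51, 114, 90), (54, 47, 100), (12, 11, 126)]),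
   ([(8, 197), (9, 263), (10, 156), (11, 144), (12, 257), (15, 252), (16, 204), (17, 171), (18,
   177), (19, 241), (21, 237), (22, 234), (23, 186), (24, 230), (25, 145), (26, 225), (28, 218),
   (29, 224), (30, 215), (31, 212), (32, 210), (33, 83), (36, 147), (38, 161), (39, 140), (40,
   193), (41, 190), (44, 184), (45, 174), (46, 160), (47, 129), (48, 169), (49, 94), (50, 163),
   (51, 198), (52, 151), (54, 153), (55, 159), (56, 146), (58, 150), (59, 180), (60, 77), (61,
   189), (62, 154), (63, 71), (64, 67), (65, 122), (68, 105), (69, 93), (74, 84), (75, 157), (76,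
   89), (78, 114), (79, 168), (80, 101), (81, 104), (82, 182), (87, 135), (88, 112), (90, 172),
   (95, 96), (97, 99), (98, 175), (102, 121), (103, 167), (106, 132), (107, 120), (108, 136), (109,
   152), (110, 130), (111, 115), (113, 142), (117, 118), (123, 148), (124, 141), (126, 133), (127,
   139)], [(13, 72, 53), (14, 20, 66), (37, 91, 73), (27, 43, 178), (57, 92, 119), (7, 35, 194)]),
   ([(7, 218), (8, 237), (9, 175), (11, 261), (12, 150), (14, 32), (15, 216), (16, 166), (17, 24),
   (18, 229), (20, 240), (21, 221), (22, 177), (23, 181), (25, 230), (26, 227), (27, 188), (28,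
   238), (29, 220), (30, 189), (31, 208), (33, 71), (34, 190), (35, 213), (36, 174), (38, 197),
   (39, 146), (42, 186), (43, 193), (44, 179), (45, 111), (48, 195), (49, 115), (51, 136), (52,
   194), (53, 159), (55, 178), (56, 196), (57, 123), (58, 95), (59, 110), (60, 138), (61, 65), (62,
   170), (64, 69), (66, 202), (67, 183), (68, 76), (70, 88), (72, 85), (75, 79), (77, 140), (78,
   87), (83, 124), (84, 172), (86, 90), (89, 168), (91, 167), (92, 130), (94, 120), (96, 163), (97,
   173), (98, 108), (99, 145), (100, 171), (101, 102), (103, 106), (105, 160), (109, 142), (113,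
   149), (114, 155), (116, 151), (117, 147), (122, 132), (128, 135), (131, 143), (134, 141), (137,
   139)], [(40, 10, 191), (19, 129, 63), (47, 74, 152), (81, 37, 82), (73, 54, 107), (80, 13,
   112)]),
   ([(7, 180), (8, 210), (9, 61), (10, 194), (11, 236), (12, 215), (13, 198), (14, 174), (15, 143),
   (16, 249), (17, 235), (18, 201), (19, 237), (20, 213), (22, 239), (23, 220), (24, 145), (26,
   155), (27, 168), (28, 238), (29, 164), (30, 224), (32, 131), (33, 246), (34, 162), (35, 241),
   (36, 234), (38, 185), (39, 232), (40, 160), (41, 184), (42, 161), (43, 229), (46, 159), (47,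
   165), (48, 226), (49, 107), (51, 60), (53, 197), (54, 209), (55, 97), (59, 186), (63, 115), (64,
   108), (65, 110), (67, 139), (68, 146), (72, 183), (73, 191), (74, 96), (76, 141), (78, 166),
   (79, 92), (80, 128), (81, 177), (83, 84), (85, 122), (87, 173), (88, 134), (89, 90), (91, 157),
   (93, 106), (94, 98), (95, 136), (99, 117), (100, 102), (104, 153), (105, 135), (113, 138), (114,
   116), (120, 147), (121, 154), (123, 150), (125, 137), (126, 151), (127, 142), (129, 149)], [(31,
   44, 57), (45, 37, 66), (25, 52, 176), (69, 50, 140), (86, 58, 124), (21, 109, 112), (56, 62,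
   71)])]

theorem initialTilings_spec : ∀ (i : ℕ) (hi : i < 18),
    tilesIoc 0 (3 * (i + 2)) (initialTilings[i]'hi).1
      (initialTilings[i]'hi).2 = true := by
  decide +kernel

theorem shiftedTilings_spec : ∀ (i : ℕ) (hi : i < 78),
    tilesIoc 6 (3 * (i + 14) + 6) (shiftedTilings[i]'hi).1
      (shiftedTilings[i]'hi).2 = true := by
  decide +kernel

/-! ### Tables for the two ends, and the recursion. -/

theorem hasTiling_lowAndTop_six : HasTiling (lowAndTop 0 6 12) :=
  ⟨([((0, 1), (1, 2)), ((0, 4), (1, 1)), ((0, 5), (1, 7)), ((0, 6), (1, 4))] : List _),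
    ([((0, 2), (1, 6), (0, 3))] : List _), by decide +kernel, by decide⟩

/-- This and the next four tables fill `7, …, 32` and `t` top numbers. No block can have two top
gaps, as their sum would have first coordinate at least 2; hence a block covers at most twice as
many top numbers as low ones. With 26 low numbers this gives `t ≤ 52`, and `26 + t` must be a
multiple of 3; the five largest such values are used. Starting the intervals at 1 instead of 7 would
leave only `1, 2` below, hence `t = 1` or `t = 4`, too few for five residues. -/
theorem hasTiling_lowAndTop_40 : HasTiling (lowAndTop 6 32 40) :=
  ⟨([((0, 7), (0, 25)), ((0, 8), (1, 17)), ((0, 9), (1, 11)), ((0, 10), (1, 18)), ((0, 11), (1,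
  16)), ((0, 19), (1, 15)), ((0, 20), (1, 6)), ((0, 22), (1, 7)), ((0, 23), (1, 10)), ((0, 24), (1,
  12)), ((0, 26), (1, 13)), ((0, 27), (1, 4)), ((0, 28), (1, 2)), ((0, 30), (1, 5))] : List _),
    ([((0, 16), (1, 3), (0, 21)), ((0, 17), (0, 12), (1, 9)), ((0, 14), (1, 8), (0, 15)), ((0, 18),
    (0, 13), (1, 1))] : List _), by decide +kernel, by decide⟩

theorem hasTiling_lowAndTop_43 : HasTiling (lowAndTop 6 32 43) :=
  ⟨([((0, 10), (1, 20)), ((0, 11), (1, 22)), ((0, 14), (1, 14)), ((0, 15), (1, 24)), ((0, 22), (1,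
  12)), ((0, 24), (1, 7)), ((0, 25), (1, 13)), ((0, 26), (1, 1)), ((0, 27), (1, 8)), ((0, 28), (1,
  15)), ((0, 29), (1, 11)), ((0, 30), (1, 2)), ((0, 32), (1, 4))] : List _),
    ([((0, 13), (0, 7), (1, 9)), ((0, 9), (0, 12), (1, 5)), ((0, 16), (1, 3), (0, 18)), ((0, 17),
    (1, 6), (0, 19)), ((0, 23), (0, 8), (1, 10))] : List _), by decide +kernel, by decide⟩

theorem hasTiling_lowAndTop_46 : HasTiling (lowAndTop 6 32 46) :=
  ⟨([((0, 11), (1, 23)), ((0, 14), (1, 11)), ((0, 17), (1, 2)), ((0, 18), (1, 21)), ((0, 22), (1,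
  4)), ((0, 24), (1, 8)), ((0, 25), (1, 5)), ((0, 27), (1, 6)), ((0, 30), (1, 10)), ((0, 32), (1,
  3))] : List _),
    ([((0, 10), (1, 7), (0, 29)), ((0, 13), (1, 15), (0, 16)), ((0, 15), (1, 1), (0, 26)), ((0,
    19), (0, 12), (1, 12)), ((0, 9), (1, 9), (0, 20)), ((0, 21), (0, 7), (1, 13)), ((0, 8), (1,
    14), (0, 23))] : List _), by decide +kernel, by decide⟩

theorem hasTiling_lowAndTop_49 : HasTiling (lowAndTop 6 32 49) :=
  ⟨([((0, 7), (1, 8)), ((0, 9), (1, 14)), ((0, 10), (1, 37)), ((0, 11), (1, 35)), ((0, 13), (1,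
  32)), ((0, 14), (1, 30)), ((0, 15), (1, 16)), ((0, 17), (1, 17)), ((0, 18), (1, 7)), ((0, 19),
  (1, 1)), ((0, 21), (1, 18)), ((0, 23), (1, 19)), ((0, 24), (1, 4)), ((0, 26), (1, 3)), ((0, 27),
  (1, 21)), ((0, 29), (1, 12)), ((0, 30), (1, 6)), ((0, 31), (1, 9)), ((0, 32), (1, 11))] : List
  _),
    ([((0, 12), (1, 10), (0, 16)), ((0, 20), (0, 8), (1, 5)), ((0, 22), (1, 2), (0, 25))] : List
    _), by decide +kernel, by decide⟩

theorem hasTiling_lowAndTop_52 : HasTiling (lowAndTop 6 32 52) :=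
  ⟨([((0, 8), (1, 11)), ((0, 10), (1, 3)), ((0, 11), (1, 18)), ((0, 12), (1, 37)), ((0, 13), (1,
  34)), ((0, 15), (1, 31)), ((0, 17), (1, 7)), ((0, 18), (1, 10)), ((0, 19), (1, 2)), ((0, 21), (1,
  1)), ((0, 22), (1, 30)), ((0, 23), (1, 27)), ((0, 24), (1, 14)), ((0, 25), (1, 17)), ((0, 26),
  (1, 25)), ((0, 27), (1, 8)), ((0, 28), (1, 16)), ((0, 29), (1, 4)), ((0, 30), (1, 15)), ((0, 32),
  (1, 9))] : List _),
    ([((0, 7), (1, 5), (0, 31)), ((0, 14), (1, 6), (0, 20)), ((0, 9), (1, 23), (0, 16))] : List _),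
    by decide +kernel, by decide⟩

theorem hasTiling_Ioc_six (h : ℕ) (hh : 14 ≤ h) :
    HasTiling (Finset.Ioc ((6 : ℕ) : ℤ) (3 * h + 6)).val := by
  induction h using Nat.strong_induction_on with
  | _ h ih =>
    by_cases hs : h < 92
    · have := hasTiling_of_tilesIoc (shiftedTilings_spec (h - 14) (by omega))
      convert this using 3
      push_cast
      omega
    -- Inflating `(6, 3k + 6]` gives `(32, 15k + 32]`, and `t` more numbers at the top must end at
    -- `3h + 6`.
    · have step : ∀ k t : ℕ, 14 ≤ k → k < h → 3 * h = 15 * k + 26 + t →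
          HasTiling (lowAndTop 6 32 t) →
          HasTiling (Finset.Ioc ((6 : ℕ) : ℤ) (3 * h + 6)).val := by
        intro k t hk hkh hkt hg
        have h1 := (ih k hkh hk).inflate_Ioc
        have h2 : HasTiling (Finset.Ioc ((32 : ℕ) : ℤ) (5 * (3 * k + 6) + 2)).val := by
          convert h1 using 3
          norm_num
        have h3 := h2.extend (by norm_num) (by push_cast; omega) hg
        convert h3 using 3
        omega
      have hr := Nat.mod_lt (h - 22) (show 0 < 5 by norm_num)
      obtain ⟨k, hk⟩ : ∃ k, k = (h - 22) / 5 := ⟨_, rfl⟩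
      -- With remainder `r` the length condition reads `t = 40 + 3 * r`. Since `92 = 5 * 14 + 22`,
      -- the bound `h ≥ 92` is exactly what yields `k ≥ 14`.
      have hd : h = 5 * k + 22 + (h - 22) % 5 := by omega
      generalize (h - 22) % 5 = r at hr hd
      interval_cases r
      · exact step k 40 (by omega) (by omega) (by omega) hasTiling_lowAndTop_40
      · exact step k 43 (by omega) (by omega) (by omega) hasTiling_lowAndTop_43
      · exact step k 46 (by omega) (by omega) (by omega) hasTiling_lowAndTop_46
      · exact step k 49 (by omega) (by omega) (by omega) hasTiling_lowAndTop_49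
      · exact step k 52 (by omega) (by omega) (by omega) hasTiling_lowAndTop_52

theorem hasTiling_Ioc_zero (h : ℕ) (hh : 2 ≤ h) :
    HasTiling (Finset.Ioc (0 : ℤ) (3 * h)).val := by
  by_cases hs : h < 20
  · have := hasTiling_of_tilesIoc (initialTilings_spec (h - 2) (by omega))
    convert this using 3
    push_cast
    omega
  -- This tiles `(6, 3h - 12]`; the table adds `1, …, 6` and the last 12 numbers. The condition `h -
  -- 6 ≥ 14` is why the explicit cases go up to 19.
  · have h1 := hasTiling_Ioc_six (h - 6) (by omega)
    have h2 := h1.extend (by norm_num) (by omega) hasTiling_lowAndTop_six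
    convert h2 using 3
    push_cast
    omega

theorem theorem3p9 :
    (∀ h : ℕ, 2 ≤ h → ∃ B : Finset (Finset (ZMod (6 * h + 1))),
      IsPerfectDifferenceFamily (6 * h + 1) {3, 4} B ∧ 1 / 14 ≤ blockRatio 4 B) ∧
    (∀ g : ℕ, g ≡ 1 [MOD 6] → 13 ≤ g → ∃ B : Finset (Finset (ZMod g)),
      IsPerfectDifferenceFamily g {3, 4} B ∧ 1 / 14 ≤ blockRatio 4 B) := by
  have key : ∀ h : ℕ, 2 ≤ h → ∃ B : Finset (Finset (ZMod (6 * h + 1))),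
      IsPerfectDifferenceFamily (6 * h + 1) {3, 4} B ∧ 1 / 14 ≤ blockRatio 4 B := fun h hh =>
    exists_isPerfectDifferenceFamily (by omega) (hasTiling_Ioc_zero h hh)
  refine ⟨key, fun g hg h13 => ?_⟩
  obtain ⟨h, rfl⟩ : ∃ h, g = 6 * h + 1 := ⟨g / 6, by unfold Nat.ModEq at hg; omega⟩
  exact key h (by omega)
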